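/- Let $G$ be a connected groupoid with finitely many objects, with source and target maps $s,t$. For an object $x$, identified with its identity arrow, let $G(x)=\{g\in G: s(g)=t(g)=x\}$ be its isotropy group. Let $A$ be an associative ring and let $\alpha=(A_g,\alpha_g)_{g\in G}$ be a partial action of $G$ on $A$. That is, for every $g\in G$, $A_{t(g)}$ is an ideal of $A$, $A_g$ is an ideal of $A_{t(g)}$, and $\alpha_g:A_{g^{-1}}\to A_g$ is an isomorphism of rings; $\alpha_y=\mathrm{id}_{A_y}$ for every object $y$; and $\alpha_{gh}$ extends the partial composition $\alpha_g\alpha_h$ whenever $s(g)=t(h)$. Assume that - $\alpha$ is unital: for each $g\in G$ there is a central idempotent $1_g$ of $A$ with $A_g=A1_g$; - $A=\bigoplus_{y} A_y$, the sum running over the objects $y$ of $G$ (so $A$ has the identity $\sum_y 1_y$); - $\alpha$ is group-type: there are an object $x_0$ and arrows $\tau_y:x_0\to y$, one for each object $y$, with $\tau_{x_0}=x_0$, such that $A_{\tau_y^{-1}}=A_{x_0}$ and $A_{\tau_y}=A_y$ for all $y$. Let $A\star_\alpha G$ be the partial skew groupoid ring: the ring of finite formal sums $\sum_{g\in G}a_g\delta_g$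 with $a_g\in A_g$, with multiplication determined by $(a_g\delta_g)(a_h\delta_h)=a_g\alpha_g(a_h1_{g^{-1}})\delta_{gh}$ if $s(g)=t(h)$, and $0$ otherwise. **Theorem.** For every object $x$ of $G$, the ring $A\star_\alpha G$ is left (respectively, right) artinian if and only if $A$ is left (respectively, right) artinian and $A_h=\{0\}$ for all but finitely many $h\in G(x)$. -/

import Mathlib

open CategoryTheory

universe v u w

/-- A partial action `α = (A_g, α_g)` of a groupoid `G` on an associative, not necessarily unital
ring `A`. An arrow `g : y ⟶ z` has source `y` and target `z`, and the product `gh` of the groupoid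
literature is `h ≫ g` here. `dom g` is `A_g`, and `dom (𝟙 z)` is `A_z`. -/
structure GroupoidPartialAction (G : Type u) [Groupoid.{v} G] (A : Type w) [NonUnitalRing A] where
  /-- The subring `A_g`. -/
  dom : ∀ {y z : G}, (y ⟶ z) → NonUnitalSubring A
  /-- `A_z` is an ideal of `A`. -/
  dom_id_mul_mem_left : ∀ (z : G) (a : A) {b : A}, b ∈ dom (𝟙 z) → a * b ∈ dom (𝟙 z)
  dom_id_mul_mem_right : ∀ (z : G) {a : A} (b : A), a ∈ dom (𝟙 z) → a * b ∈ dom (𝟙 z)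
  /-- `A_g` is an ideal of `A_{t(g)}`. -/
  dom_le : ∀ {y z : G} (g : y ⟶ z), dom g ≤ dom (𝟙 z)
  dom_mul_mem_left : ∀ {y z : G} (g : y ⟶ z) {a b : A}, a ∈ dom (𝟙 z) → b ∈ dom g → a * b ∈ dom g
  dom_mul_mem_right : ∀ {y z : G} (g : y ⟶ z) {a b : A}, a ∈ dom g → b ∈ dom (𝟙 z) → a * b ∈ dom g
  /-- The ring isomorphism `α_g : A_{g⁻¹} → A_g`. -/
  map : ∀ {y z : G} (g : y ⟶ z), dom (Groupoid.inv g) ≃+* dom g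
  /-- `α_y` is the identity of `A_y`. -/
  map_id : ∀ (y : G) (a : dom (Groupoid.inv (𝟙 y))), (map (𝟙 y) a : A) = a
  /-- `α_{gh}` extends `α_g α_h`: whenever `α_g (α_h a)` is defined, so is `α_{gh} a`, and the two
  are equal. -/
  map_comp : ∀ {x y z : G} (h : x ⟶ y) (g : y ⟶ z) (a : A) (ha : a ∈ dom (Groupoid.inv h))
    (hb : (map h ⟨a, ha⟩ : A) ∈ dom (Groupoid.inv g)),
    ∃ hc : a ∈ dom (Groupoid.inv (h ≫ g)),
      (map (h ≫ g) ⟨a, hc⟩ : A) = map g ⟨(map h ⟨a, ha⟩ : A), hb⟩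

namespace GroupoidPartialAction

variable {G : Type u} [Groupoid.{v} G] {A : Type w} [NonUnitalRing A]

/-- `α` is unital: for each `g` there is a central idempotent `1_g` of `A` with `A_g = A 1_g`. -/
def IsUnital (α : GroupoidPartialAction G A) : Prop :=
  ∀ ⦃y z : G⦄ (g : y ⟶ z), ∃ e : A, e ∈ Set.center A ∧ e * e = e ∧
    (α.dom g : Set A) = Set.range fun a : A => a * e

/-- `α` is group-type: for some object `x` there is a transversal `τ_y : x ⟶ y` with
`τ_x = id_x` such that `A_{τ_y⁻¹} = A_x` and `A_{τ_y} = A_y` for all objects `y`. -/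
def IsGroupType (α : GroupoidPartialAction G A) : Prop :=
  ∃ (x : G) (τ : ∀ y : G, x ⟶ y), τ x = 𝟙 x ∧
    ∀ y : G, α.dom (Groupoid.inv (τ y)) = α.dom (𝟙 x) ∧ α.dom (τ y) = α.dom (𝟙 y)

open Classical in
/-- `A` is the (internal) direct sum of the ideals `A_y`, where `y` runs over the objects. -/
def IsDirectSumOfObjects (α : GroupoidPartialAction G A) : Prop :=
  DirectSum.IsInternal fun y : G => (α.dom (𝟙 y)).toAddSubgroup

section Unital

variable {α : GroupoidPartialAction G A}

/-- The central idempotent `1_g` (it is the identity element of `A_g`, hence unique). -/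
noncomputable def IsUnital.one (hα : α.IsUnital) {y z : G} (g : y ⟶ z) : A := (hα g).choose

theorem IsUnital.one_mem_center (hα : α.IsUnital) {y z : G} (g : y ⟶ z) :
    hα.one g ∈ Set.center A := (hα g).choose_spec.1

theorem IsUnital.one_comm (hα : α.IsUnital) {y z : G} (g : y ⟶ z) (a : A) :
    hα.one g * a = a * hα.one g := ((hα.one_mem_center g).comm a).eq

theorem IsUnital.one_mul_one (hα : α.IsUnital) {y z : G} (g : y ⟶ z) :
    hα.one g * hα.one g = hα.one g := (hα g).choose_spec.2.1

theorem IsUnital.mem_iff (hα : α.IsUnital) {y z : G} (g : y ⟶ z) (a : A) :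
    a ∈ α.dom g ↔ a * hα.one g = a := by
  have h : (α.dom g : Set A) = Set.range fun a : A => a * hα.one g := (hα g).choose_spec.2.2
  rw [← SetLike.mem_coe, h]
  constructor
  · rintro ⟨b, rfl⟩
    simp only [mul_assoc, hα.one_mul_one]
  · intro h
    exact ⟨a, h⟩

theorem IsUnital.one_mem (hα : α.IsUnital) {y z : G} (g : y ⟶ z) : hα.one g ∈ α.dom g :=
  (hα.mem_iff g _).2 (hα.one_mul_one g)

theorem IsUnital.mul_mem_left (hα : α.IsUnital) {y z : G} (g : y ⟶ z) (a : A) {b : A}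
    (hb : b ∈ α.dom g) : a * b ∈ α.dom g := by
  rw [hα.mem_iff] at hb ⊢
  rw [mul_assoc, hb]

theorem IsUnital.mul_mem_right (hα : α.IsUnital) {y z : G} (g : y ⟶ z) {a : A} (b : A)
    (ha : a ∈ α.dom g) : a * b ∈ α.dom g := by
  rw [hα.mem_iff] at ha ⊢
  rw [mul_assoc, ← hα.one_comm, ← mul_assoc, ha]

theorem IsUnital.mul_one_mul_one (hα : α.IsUnital) {y z : G} (g : y ⟶ z) (a b : A) :
    a * b * hα.one g = a * hα.one g * (b * hα.one g) := by
  rw [mul_assoc a (hα.one g), ← mul_assoc (hα.one g), hα.one_comm, mul_assoc b, hα.one_mul_one,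
    mul_assoc]

/-- The map `A → A`, `a ↦ α_g (a 1_{g⁻¹})`. -/
noncomputable def IsUnital.act (hα : α.IsUnital) {y z : G} (g : y ⟶ z) : A →ₙ+* A where
  toFun a := α.map g ⟨a * hα.one (Groupoid.inv g), hα.mul_mem_left _ a (hα.one_mem _)⟩
  map_zero' := by
    have : (⟨0 * hα.one (Groupoid.inv g), hα.mul_mem_left _ 0 (hα.one_mem _)⟩ :
      α.dom (Groupoid.inv g)) = 0 := Subtype.ext (zero_mul _)
    rw [this, map_zero]; rfl
  map_add' a b := by
    refine Eq.trans ?_ (congrArg Subtype.val (map_add (α.map g) _ _))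
    congr 2
    exact Subtype.ext (add_mul _ _ _)
  map_mul' a b := by
    refine Eq.trans ?_ (congrArg Subtype.val (map_mul (α.map g) _ _))
    congr 2
    exact Subtype.ext (hα.mul_one_mul_one _ _ _)

theorem IsUnital.act_mem (hα : α.IsUnital) {y z : G} (g : y ⟶ z) (a : A) :
    hα.act g a ∈ α.dom g := SetLike.coe_mem _

theorem IsUnital.act_eq (hα : α.IsUnital) {y z : G} (g : y ⟶ z) {a : A}
    (ha : a ∈ α.dom (Groupoid.inv g)) : hα.act g a = α.map g ⟨a, ha⟩ := by
  change (α.map g ⟨a * hα.one (Groupoid.inv g), _⟩ : A) = _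
  congr 2
  exact Subtype.ext ((hα.mem_iff _ _).1 ha)

theorem IsUnital.act_mul_one (hα : α.IsUnital) {y z : G} (g : y ⟶ z) (a : A) :
    hα.act g (a * hα.one (Groupoid.inv g)) = hα.act g a :=
  hα.act_eq g (hα.mul_mem_left _ a (hα.one_mem _))

theorem IsUnital.act_id (hα : α.IsUnital) (y : G) (a : A) :
    hα.act (𝟙 y) a = a * hα.one (𝟙 y) := by
  have h := α.map_id y ⟨a * hα.one (Groupoid.inv (𝟙 y)), hα.mul_mem_left _ a (hα.one_mem _)⟩
  refine h.trans ?_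
  have : Groupoid.inv (𝟙 y) = 𝟙 y := by simp
  change a * hα.one (Groupoid.inv (𝟙 y)) = _
  rw [this]

theorem IsUnital.exists_act_eq (hα : α.IsUnital) {y z : G} (g : y ⟶ z) {b : A}
    (hb : b ∈ α.dom g) : ∃ a ∈ α.dom (Groupoid.inv g), hα.act g a = b := by
  obtain ⟨⟨a, ha⟩, h⟩ := (α.map g).surjective ⟨b, hb⟩
  exact ⟨a, ha, by rw [hα.act_eq g ha, h]⟩

theorem IsUnital.act_comp (hα : α.IsUnital) {x y z : G} (h : x ⟶ y) (g : y ⟶ z) {a : A}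
    (ha : a ∈ α.dom (Groupoid.inv h)) (hb : hα.act h a ∈ α.dom (Groupoid.inv g)) :
    a ∈ α.dom (Groupoid.inv (h ≫ g)) ∧ hα.act (h ≫ g) a = hα.act g (hα.act h a) := by
  have e := hα.act_eq h ha
  have hb' := hb
  rw [e] at hb'
  obtain ⟨hc, h2⟩ := α.map_comp h g a ha hb'
  refine ⟨hc, ?_⟩
  rw [hα.act_eq _ hc, h2, e, hα.act_eq g hb']

theorem IsUnital.act_mem_comp (hα : α.IsUnital) {x y z : G} (h : x ⟶ y) (g : y ⟶ z) {b : A}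
    (hb : b ∈ α.dom h) : hα.act g b ∈ α.dom (h ≫ g) := by
  obtain ⟨a, ha, hab⟩ := hα.exists_act_eq h
    (hα.mul_mem_right h (hα.one (Groupoid.inv g)) hb)
  have hm : hα.act h a ∈ α.dom (Groupoid.inv g) := by
    rw [hab]; exact hα.mul_mem_left _ _ (hα.one_mem _)
  rw [← hα.act_mul_one, ← hab, ← (hα.act_comp h g ha hm).2]
  exact hα.act_mem _ _

theorem IsUnital.act_act_inv (hα : α.IsUnital) {y z : G} (g : y ⟶ z) {b : A}
    (hb : b ∈ α.dom g) : hα.act g (hα.act (Groupoid.inv g) b) = b := by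
  have h1 : Groupoid.inv (Groupoid.inv g) = g := by simp
  have h := hα.act_comp (Groupoid.inv g) g (a := b) (by rwa [h1]) (hα.act_mem _ _)
  rw [← h.2, Groupoid.inv_comp, hα.act_id]
  exact (hα.mem_iff _ _).1 (α.dom_le g hb)

theorem IsUnital.act_one (hα : α.IsUnital) {x y z : G} (h : x ⟶ y) (g : y ⟶ z) :
    hα.act g (hα.one h) = hα.one g * hα.one (h ≫ g) := by
  have hp : hα.act g (hα.one h) * (hα.one g * hα.one (h ≫ g)) = hα.act g (hα.one h) := by
    rw [← mul_assoc, (hα.mem_iff g _).1 (hα.act_mem _ _),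
      (hα.mem_iff _ _).1 (hα.act_mem_comp h g (hα.one_mem h))]
  set q := hα.one g * hα.one (h ≫ g) with hq
  have hqg : q ∈ α.dom g := hα.mul_mem_right _ _ (hα.one_mem g)
  have hqgh : q ∈ α.dom (h ≫ g) := hα.mul_mem_left _ _ (hα.one_mem _)
  have hr := hα.act_mem_comp (h ≫ g) (Groupoid.inv g) hqgh
  rw [Category.assoc, Groupoid.comp_inv, Category.comp_id] at hr
  have h2 := congrArg (hα.act g) ((hα.mem_iff _ _).1 hr)
  rw [map_mul, hα.act_act_inv g hqg] at h2
  have h3 : q * hα.act g (hα.one h) = hα.act g (hα.one h) * q := by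
    rw [hq, mul_assoc, hα.one_comm, hα.one_comm, mul_assoc, hα.one_comm]
  rw [← hp, ← h3, h2]

theorem IsUnital.act_act (hα : α.IsUnital) {x y z : G} (h : x ⟶ y) (g : y ⟶ z) (a : A) :
    hα.act g (hα.act h a) = hα.act (h ≫ g) a * hα.one g := by
  obtain ⟨w, hw, hwe⟩ := hα.exists_act_eq h
    (hα.mul_mem_right h (hα.one (Groupoid.inv g)) (hα.one_mem h))
  have hm : hα.act h w ∈ α.dom (Groupoid.inv g) := by
    rw [hwe]; exact hα.mul_mem_left _ _ (hα.one_mem _)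
  have e1 : hα.act h (a * w) = hα.act h a * hα.one (Groupoid.inv g) := by
    rw [map_mul, hwe, ← mul_assoc, (hα.mem_iff h _).1 (hα.act_mem h a)]
  have h1 := hα.act_comp h g hw hm
  have h2 := hα.act_comp h g (a := a * w) (hα.mul_mem_left _ _ hw)
    (by rw [e1]; exact hα.mul_mem_left _ _ (hα.one_mem _))
  rw [← hα.act_mul_one g, ← e1, ← h2.2, map_mul, h1.2, hwe, hα.act_mul_one, hα.act_one,
    hα.one_comm, ← mul_assoc, (hα.mem_iff _ _).1 (hα.act_mem _ _)]

end Unital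

/-- The set of all arrows of the groupoid: triples (source, target, arrow). -/
abbrev Arr (G : Type u) [Groupoid.{v} G] : Type (max u v) := Σ y z : G, y ⟶ z

/-- The partial skew groupoid ring `A ⋆_α G` of a unital partial action: the finite formal sums
`∑ a_g δ_g` over the arrows `g` of `G`, with `a_g ∈ A_g`. -/
def SkewRing (α : GroupoidPartialAction G A) (_hα : α.IsUnital) : Type (max u v w) :=
  DirectSum (Arr G) fun g => α.dom g.2.2

namespace SkewRing

variable {α : GroupoidPartialAction G A} (hα : α.IsUnital)

noncomputable instance : AddCommGroup (SkewRing α hα) :=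
  inferInstanceAs (AddCommGroup (DirectSum (Arr G) fun g => α.dom g.2.2))

open Classical in
/-- The additive map `a ↦ a δ_g`, from `A_g` to `A ⋆_α G`. -/
noncomputable def single (g : Arr G) : α.dom g.2.2 →+ SkewRing α hα :=
  DirectSum.of (fun g : Arr G => α.dom g.2.2) g

theorem single_eq {g h : Arr G} (e : g = h) {a : α.dom g.2.2} {b : α.dom h.2.2}
    (hab : (a : A) = b) : single hα g a = single hα h b := by
  subst e
  rw [Subtype.ext hab]

variable {hα} in
theorem addHom_ext {M : Type*} [AddZeroClass M] {f f' : SkewRing α hα →+ M}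
    (H : ∀ g a, f (single hα g a) = f' (single hα g a)) : f = f' := by
  classical
  exact DirectSum.addHom_ext H

/-- The element `a_g α_g (a_h 1_{g⁻¹})` of `A_{gh}`, biadditive in `a_g` and `a_h`. -/
noncomputable def mulCoeff {x y z : G} (g : y ⟶ z) (h : x ⟶ y) :
    α.dom g →+ α.dom h →+ α.dom (h ≫ g) :=
  AddMonoidHom.mk' (fun a => AddMonoidHom.mk'
      (fun b => ⟨a * hα.act g b, hα.mul_mem_left _ _ (hα.act_mem_comp h g b.2)⟩)
      (fun b c => Subtype.ext (by simp [mul_add])))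
    (fun a c => by ext b; simp [add_mul])

open Classical in
/-- The product of `a_g δ_g` and `a_h δ_h`: it is `a_g α_g (a_h 1_{g⁻¹}) δ_{gh}` if `s(g) = t(h)`,
and zero otherwise. -/
noncomputable def mulSingle :
    (g h : Arr G) → α.dom g.2.2 →+ α.dom h.2.2 →+ SkewRing α hα
  | ⟨y, z, g⟩, ⟨x, y', h⟩ =>
    if e : y' = y then by
      subst e
      exact (AddMonoidHom.compHom (single hα ⟨x, z, h ≫ g⟩)).comp (mulCoeff hα g h)
    else 0

open Classical in
/-- The multiplication of `A ⋆_α G`, the biadditive extension of `mulSingle`. -/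
noncomputable def mulHom : SkewRing α hα →+ SkewRing α hα →+ SkewRing α hα :=
  DirectSum.toAddMonoid fun g =>
    AddMonoidHom.flip (DirectSum.toAddMonoid fun h => AddMonoidHom.flip (mulSingle hα g h))

noncomputable instance : Mul (SkewRing α hα) := ⟨fun a b => mulHom hα a b⟩

theorem mul_def (a b : SkewRing α hα) : a * b = mulHom hα a b := rfl

theorem mulHom_single (g h : Arr G) (a : α.dom g.2.2) (b : α.dom h.2.2) :
    mulHom hα (single hα g a) (single hα h b) = mulSingle hα g h a b := by
  classical
  have h1 := DirectSum.toAddMonoid_of (fun g : Arr G => AddMonoidHom.flip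
    (DirectSum.toAddMonoid fun h : Arr G => AddMonoidHom.flip (mulSingle hα g h))) g a
  have h2 := DirectSum.toAddMonoid_of
    (fun h : Arr G => AddMonoidHom.flip (mulSingle hα g h)) h b
  have h1' : mulHom hα (single hα g a) = (AddMonoidHom.flip
    (DirectSum.toAddMonoid fun h : Arr G => AddMonoidHom.flip (mulSingle hα g h))) a := h1
  rw [h1']
  exact DFunLike.congr_fun h2 a

/-- `(a δ_g) (b δ_h) = a α_g (b 1_{g⁻¹}) δ_{gh}` for composable arrows. -/
theorem single_mul_single {x y z : G} (g : y ⟶ z) (h : x ⟶ y) (a : α.dom g) (b : α.dom h) :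
    single hα ⟨y, z, g⟩ a * single hα ⟨x, y, h⟩ b =
      single hα ⟨x, z, h ≫ g⟩
        ⟨a * hα.act g b, hα.mul_mem_left _ _ (hα.act_mem_comp h g b.2)⟩ := by
  rw [mul_def, mulHom_single]
  simp [mulSingle]
  rfl

/-- `(a δ_g) (b δ_h) = 0` if `s(g) ≠ t(h)`. -/
theorem single_mul_single_of_ne {g h : Arr G} (e : h.2.1 ≠ g.1) (a : α.dom g.2.2)
    (b : α.dom h.2.2) : single hα g a * single hα h b = 0 := by
  obtain ⟨y, z, g⟩ := g
  obtain ⟨x, y', h⟩ := h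
  rw [mul_def, mulHom_single]
  have e' : ¬ y' = y := e
  simp [mulSingle, e']

theorem mul_assoc_single (g h k : Arr G) (a : α.dom g.2.2) (b : α.dom h.2.2) (c : α.dom k.2.2) :
    single hα g a * single hα h b * single hα k c =
      single hα g a * (single hα h b * single hα k c) := by
  have zl : ∀ s : SkewRing α hα, 0 * s = 0 := fun s => by simp [mul_def]
  have zr : ∀ s : SkewRing α hα, s * 0 = 0 := fun s => by simp [mul_def]
  obtain ⟨y, z, g⟩ := g
  obtain ⟨x, y', h⟩ := h
  obtain ⟨w, x', k⟩ := k
  by_cases e1 : y' = y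
  · subst e1
    by_cases e2 : x' = x
    · subst e2
      rw [single_mul_single, single_mul_single, single_mul_single, single_mul_single]
      refine single_eq hα (by rw [Category.assoc]) ?_
      change (a : A) * hα.act g b * hα.act (h ≫ g) c = a * hα.act g (b * hα.act h c)
      rw [map_mul, hα.act_act, ← hα.one_comm, ← mul_assoc (hα.act g b),
        (hα.mem_iff g _).1 (hα.act_mem g b), mul_assoc]
    · rw [single_mul_single, single_mul_single_of_ne hα (by exact e2),
        single_mul_single_of_ne hα (by exact e2), zr]
  · rw [single_mul_single_of_ne hα (by exact e1), zl]
    by_cases e2 : x' = x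
    · subst e2
      rw [single_mul_single, single_mul_single_of_ne hα (by exact e1)]
    · rw [single_mul_single_of_ne hα (by exact e2), zr]

noncomputable instance : NonUnitalRing (SkewRing α hα) where
  left_distrib a b c := by simp [mul_def]
  right_distrib a b c := by simp [mul_def]
  zero_mul a := by simp [mul_def]
  mul_zero a := by simp [mul_def]
  mul_assoc a b c := by
    have H : (AddMonoidHom.compHom (mulHom hα)).comp (mulHom hα) =
        (AddMonoidHom.compHom.flip (mulHom hα)).comp
          ((AddMonoidHom.compHom (M := SkewRing α hα)).comp (mulHom hα)) := by
      refine addHom_ext fun g a => addHom_ext fun h b => addHom_ext fun k c => ?_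
      exact mul_assoc_single hα g h k a b c
    exact DFunLike.congr_fun (DFunLike.congr_fun (DFunLike.congr_fun H a) b) c

/-- The identity element `∑ 1_y δ_y`, the sum over all objects `y`, of which there are finitely
many. -/
noncomputable instance [Finite G] : One (SkewRing α hα) :=
  letI := Fintype.ofFinite G
  ⟨∑ y : G, single hα ⟨y, y, 𝟙 y⟩ ⟨hα.one (𝟙 y), hα.one_mem _⟩⟩

theorem one_mul_single [Finite G] (g : Arr G) (a : α.dom g.2.2) :
    1 * single hα g a = single hα g a := by
  let _ := Fintype.ofFinite G
  change (∑ y : G, single hα ⟨y, y, 𝟙 y⟩ ⟨hα.one (𝟙 y), hα.one_mem _⟩) * _ = _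
  obtain ⟨y, z, g⟩ := g
  rw [Finset.sum_mul, Finset.sum_eq_single z]
  · rw [single_mul_single]
    refine single_eq hα (by rw [Category.comp_id]) ?_
    change hα.one (𝟙 z) * hα.act (𝟙 z) a = a
    rw [hα.act_id, hα.one_comm, mul_assoc, hα.one_mul_one]
    exact (hα.mem_iff _ _).1 (α.dom_le g a.2)
  · intro b _ hb
    exact single_mul_single_of_ne hα (fun h => hb h.symm) _ _
  · simp

theorem single_mul_one [Finite G] (g : Arr G) (a : α.dom g.2.2) :
    single hα g a * 1 = single hα g a := by
  let _ := Fintype.ofFinite G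
  change _ * (∑ y : G, single hα ⟨y, y, 𝟙 y⟩ ⟨hα.one (𝟙 y), hα.one_mem _⟩) = _
  obtain ⟨y, z, g⟩ := g
  rw [Finset.mul_sum, Finset.sum_eq_single y]
  · rw [single_mul_single]
    refine single_eq hα (by rw [Category.id_comp]) ?_
    change (a : A) * hα.act g (hα.one (𝟙 y)) = a
    rw [hα.act_one, Category.id_comp, hα.one_mul_one]
    exact (hα.mem_iff _ _).1 a.2
  · intro b _ hb
    exact single_mul_single_of_ne hα hb _ _
  · simp

noncomputable instance [Finite G] : Ring (SkewRing α hα) where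
  __ := (inferInstance : NonUnitalRing (SkewRing α hα))
  one := 1
  one_mul s := by
    have H : mulHom hα 1 = AddMonoidHom.id _ :=
      addHom_ext fun g a => one_mul_single hα g a
    exact DFunLike.congr_fun H s
  mul_one s := by
    have H : (mulHom hα).flip 1 = AddMonoidHom.id _ :=
      addHom_ext fun g a => single_mul_one hα g a
    exact DFunLike.congr_fun H s

end SkewRing

end GroupoidPartialAction

/-! Suppose first that `A` is artinian and that only finitely many `A_h` with `h` in `G(x)` are
nonzero. Since `α` is group-type, translating an arrow by the `τ_y` turns it into a loop at `x`
without killing its ideal, so only finitely many `A_g` are nonzero at all (`finite_arr`). The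
elements `1_g δ_g` with `A_g ≠ 0` then generate the skew ring as a module over `A`, on the left and
on the right, and a finitely generated module over an artinian ring is artinian.

For the converse, the engine is `IsArtinianRing.of_retraction`: left ideals of `R` extend to left
ideals of `S`, and an additive map `E : S → R` that respects right multiplication by the image of
`ψ` recovers them. With `E` the sum of the coefficients at the objects, this shows that `A` is
artinian.

If infinitely many `A_h` were nonzero, minimality among central idempotents of `A` would give a
nonzero central idempotent `f` whose stabilizer `K` in `G(x)` is infinite
(`exists_infinite_stabilizer`). An additive map `φ : A → F` into a prime field with `φ f = 1` makes
`a δ_k ↦ φ(a f) k` a retraction onto `F[K]`, so `F[K]` is artinian. By Connell's theorem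
(`MonoidAlgebra.finite_of_isArtinianRing`) `K` is finite, a contradiction. The right-hand statement
follows from the same left-hand lemmas applied to opposite rings. -/

/-! ### Descent of the artinian property along retractions -/

/-- Left artinian descent along an additive retraction `E` that is linear over the image of `ψ`. -/
theorem IsArtinianRing.of_retraction {P R S : Type*} [Ring R] [Ring S] (ψ : P → S) (π : P → R)
    (E : S →+ R) (hE : ∀ s p, E (s * ψ p) = E s * π p) (hψ : ∀ p, E (ψ p) = π p)
    (hπ : ∀ r, ∃ p c d, c * r = π p ∧ r = d * π p) [IsArtinianRing S] : IsArtinianRing R := by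
  let Φ : Ideal R → Ideal S := fun L => Ideal.span (ψ '' (π ⁻¹' (L : Set R)))
  have key : ∀ L : Ideal R, ∀ s ∈ Φ L, E s ∈ L := by
    intro L s hs
    -- `E` is linear only on the right, so the induction must carry an arbitrary left factor `t`; it
    -- is set to `1` at the end.
    refine Submodule.span_induction (p := fun s _ => ∀ t, E (t * s) ∈ L) ?_ ?_ ?_ ?_ hs 1 |> fun h => by
      simpa using h
    · rintro _ ⟨p, hp, rfl⟩ t
      rw [hE]
      exact L.mul_mem_left _ hp
    · simp
    · intro a b _ _ ha hb t
      rw [mul_add, map_add]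
      exact L.add_mem (ha t) (hb t)
    · intro a b _ hb t
      rw [smul_eq_mul, ← mul_assoc]
      exact hb _
  have hle : ∀ L L' : Ideal R, Φ L ≤ Φ L' → L ≤ L' := by
    intro L L' h r hr
    obtain ⟨p, c, d, h1, h2⟩ := hπ r
    rw [h2]
    refine L'.mul_mem_left _ ?_
    rw [← hψ]
    refine key L' _ (h (Ideal.subset_span ⟨p, ?_, rfl⟩))
    rw [Set.mem_preimage, ← h1]
    exact L.mul_mem_left _ hr
  have hmono : StrictMono Φ := by
    refine Monotone.strictMono_of_injective (fun L L' h => ?_) (fun L L' h => ?_)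
    · exact Ideal.span_mono (Set.image_mono (Set.preimage_mono h))
    · exact le_antisymm (hle _ _ h.le) (hle _ _ h.ge)
  exact hmono.wellFoundedLT

namespace MonoidAlgebra

/-- `S` need not be an `F`-algebra and `ψ` need not be multiplicative, so only integral combinations
of the `ψ k` are available in `S`. They suffice: by `hF`, clearing denominators turns any element of
`F[Q]` into an integral combination of group elements, up to a unit. -/
theorem isArtinianRing_of_retraction {F Q S : Type*} [Field F] [Group Q] [Ring S]
    (hF : ∀ c : F, ∃ n m : ℤ, (n : F) ≠ 0 ∧ n * c = m)
    (ψ : Q → S) (E : S →+ MonoidAlgebra F Q) (hE : ∀ s k, E (s * ψ k) = E s * single k 1)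
    (hψ : ∀ k, E (ψ k) = single k 1) [IsArtinianRing S] :
    IsArtinianRing (MonoidAlgebra F Q) := by
  have hfrac : ∀ r : MonoidAlgebra F Q, ∃ n : ℤ, (n : F) ≠ 0 ∧ ∃ p : Q →₀ ℤ,
      n • r = p.sum fun k m => m • single k 1 := by
    intro r
    induction r using MonoidAlgebra.induction_linear with
    | zero => exact ⟨1, by simp, 0, by simp⟩
    | add a b ha hb =>
      obtain ⟨n, hn, p, hp⟩ := ha
      obtain ⟨n', hn', p', hp'⟩ := hb
      refine ⟨n * n', by simp [hn, hn'], n' • p + n • p', ?_⟩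
      rw [Finsupp.sum_add_index' (by simp) (by intros; rw [add_smul]),
        Finsupp.sum_smul_index' (by simp), Finsupp.sum_smul_index' (by simp), smul_add]
      simp only [smul_assoc]
      rw [← Finsupp.smul_sum, ← Finsupp.smul_sum, ← hp, ← hp', mul_comm n n', mul_smul, mul_comm,
        mul_smul]
    | single k c =>
      obtain ⟨n, m, hn, h⟩ := hF c
      refine ⟨n, hn, Finsupp.single k m, ?_⟩
      rw [Finsupp.sum_single_index (by simp), smul_single, smul_single]
      simp [← h]
  refine IsArtinianRing.of_retraction (P := Q →₀ ℤ) (fun p => p.sum fun k m => m • ψ k)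
    (fun p => p.sum fun k m => m • single k 1) E ?_ ?_ ?_
  · intro s p
    simp only [Finsupp.sum, Finset.mul_sum, map_sum, mul_smul_comm, map_zsmul, hE]
  · intro p
    simp only [Finsupp.sum, map_sum, map_zsmul, hψ]
  · intro r
    obtain ⟨n, hn, p, hp⟩ := hfrac r
    refine ⟨p, (n : MonoidAlgebra F Q), algebraMap F _ (n : F)⁻¹, ?_, ?_⟩
    · rw [← hp, zsmul_eq_mul]
    · rw [← hp, zsmul_eq_mul, ← mul_assoc, ← map_intCast (algebraMap F (MonoidAlgebra F Q)),
        ← map_mul, inv_mul_cancel₀ hn, map_one, one_mul]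

/-! ### Subgroups as left ideals of the group ring -/

section Subgroups

variable {F K : Type*} [Field F] [Group K]

/-- The left ideal generated by the elements `u - 1` with `u ∈ U`. -/
noncomputable def subgroupIdeal (F : Type*) [Field F] (U : Subgroup K) :
    Ideal (MonoidAlgebra F K) :=
  Ideal.span ((fun u : K => single u (1 : F) - 1) '' U)

/-- The additive map `F[K] → F[K/U]`. -/
noncomputable def cosetSum (F : Type*) [Field F] (U : Subgroup K) :
    MonoidAlgebra F K →+ (K ⧸ U →₀ F) :=
  (Finsupp.mapDomain.addMonoidHom (QuotientGroup.mk : K → K ⧸ U)).comp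
    coeffAddEquiv.toAddMonoidHom

theorem cosetSum_single (U : Subgroup K) (k : K) (c : F) :
    cosetSum F U (single k c) = Finsupp.single (k : K ⧸ U) c := by
  simp [cosetSum]

theorem cosetSum_eq_zero {U : Subgroup K} {s : MonoidAlgebra F K}
    (hs : s ∈ subgroupIdeal F U) : cosetSum F U s = 0 := by
  -- Again with a free left factor: on generators, `t (u - 1)` dies in `F[K/U]` because `k u` and
  -- `k` lie in the same left coset.
  refine Submodule.span_induction (p := fun s _ => ∀ t, cosetSum F U (t * s) = 0) ?_ ?_ ?_ ?_ hs 1 |>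
    fun h => by simpa using h
  · rintro _ ⟨p, hp, rfl⟩ t
    induction t using MonoidAlgebra.induction_linear with
    | zero => simp
    | add a b ha hb => rw [add_mul, map_add, ha, hb, add_zero]
    | single k c =>
      have hkp : ((k * p : K) : K ⧸ U) = k := by
        rw [eq_comm, QuotientGroup.eq, inv_mul_cancel_left]
        exact hp
      simp [mul_sub, single_mul_single, cosetSum_single, hkp]
  · simp
  · intro a b _ _ ha hb t
    rw [mul_add, map_add, ha, hb, add_zero]
  · intro a b _ hb t
    rw [smul_eq_mul, ← mul_assoc]
    exact hb _

theorem mem_of_single_sub_one_mem {U : Subgroup K} {u : K}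
    (h : single u (1 : F) - 1 ∈ subgroupIdeal F U) : u ∈ U := by
  have h1 := cosetSum_eq_zero h
  rw [map_sub, one_def, cosetSum_single, cosetSum_single, sub_eq_zero] at h1
  have := Finsupp.single_left_injective (one_ne_zero (α := F)) h1
  simpa using (QuotientGroup.eq.1 this)

/-- `U` is recovered from its ideal as the set of `u` with `u - 1` in it. Hence both chain
conditions pass from left ideals to subgroups; the ascending one holds because an artinian ring is
noetherian. -/
theorem subgroupIdeal_strictMono : StrictMono (subgroupIdeal F : Subgroup K → _) := by
  refine Monotone.strictMono_of_injective (fun U U' h => ?_) (fun U U' h => ?_)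
  · exact Ideal.span_mono (Set.image_mono h)
  · have : ∀ U U' : Subgroup K, subgroupIdeal F U = subgroupIdeal F U' → U ≤ U' :=
      fun U U' h u hu => mem_of_single_sub_one_mem (F := F) (h ▸ Ideal.subset_span ⟨u, hu, rfl⟩)
    exact le_antisymm (this _ _ h) (this _ _ h.symm)

theorem wellFoundedLT_subgroup (F : Type*) [Field F] [IsArtinianRing (MonoidAlgebra F K)] :
    WellFoundedLT (Subgroup K) :=
  (subgroupIdeal_strictMono (F := F)).wellFoundedLT

theorem wellFoundedGT_subgroup (F : Type*) [Field F] [IsArtinianRing (MonoidAlgebra F K)] :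
    WellFoundedGT (Subgroup K) :=
  (subgroupIdeal_strictMono (F := F)).wellFoundedGT

end Subgroups

/-! ### Artinian group rings without nontrivial finite conjugacy classes -/

section Prime

variable {F K : Type*} [Field F] [Group K]

open scoped Pointwise in
/-- Connell: a group ring is prime if the group has no nontrivial finite conjugacy class. -/
theorem eq_zero_or_eq_zero_of_forall_mul_mul
    (hK : ∀ k : K, (Subgroup.centralizer {k}).FiniteIndex → k = 1) {a b : MonoidAlgebra F K}
    (h : ∀ x : K, a * single x 1 * b = 0) : a = 0 ∨ b = 0 := by
  classical
  by_contra! hab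
  obtain ⟨ha, hb⟩ := hab
  obtain ⟨p, hp⟩ : ∃ p, a.coeff p ≠ 0 := by
    by_contra! h0; exact ha (by ext k; simpa using h0 k)
  obtain ⟨q, hq⟩ : ∃ q, b.coeff q ≠ 0 := by
    by_contra! h0; exact hb (by ext k; simpa using h0 k)
  -- for each `x`, the term `p x q` must cancel against another one
  have hx : ∀ x : K, ∃ i ∈ a.coeff.support, ∃ j ∈ b.coeff.support, i ≠ p ∧ i * x * j = p * x * q := by
    intro x
    by_contra! hc
    have h1 : (a * single x 1 * b).coeff (p * x * q) = a.coeff p * b.coeff q := by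
      rw [mul_assoc, coeff_mul_apply_left, Finsupp.sum, Finset.sum_eq_single p]
      · simp [coeff_single_mul_apply, mul_assoc]
      · intro i hi hip
        rw [coeff_single_mul_apply, one_mul]
        by_contra h0
        refine hc i hi _ (Finsupp.mem_support_iff.2 (right_ne_zero_of_mul h0)) hip ?_
        group
      · intro h0
        rw [Finsupp.notMem_support_iff.1 h0, zero_mul]
    rw [h x] at h1
    exact mul_ne_zero hp hq (by simpa using h1.symm)
  -- For fixed `i, j` the solutions `x` of `i x j = p x q` form a left coset of the centralizer of
  -- `j q⁻¹`. Finitely many such cosets cover `K`, so by B. H. Neumann's lemma one of these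
  -- centralizers has finite index; then `j = q`, which forces `i = p`.
  let s : Finset (K × K) := (a.coeff.support ×ˢ b.coeff.support).filter fun ij =>
    ij.1 ≠ p ∧ ∃ x, ij.1 * x * ij.2 = p * x * q
  let g : K × K → K := fun ij => if hx : ∃ x, ij.1 * x * ij.2 = p * x * q then hx.choose else 1
  have hcov : ⋃ ij ∈ s, g ij • ((Subgroup.centralizer {ij.2 * q⁻¹} : Subgroup K) : Set K)
      = Set.univ := by
    refine Set.eq_univ_of_forall fun x => ?_
    obtain ⟨i, hi, j, hj, hip, hij⟩ := hx x
    have hex : ∃ x, i * x * j = p * x * q := ⟨x, hij⟩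
    simp only [Set.mem_iUnion]
    refine ⟨(i, j), by simp only [s, Finset.mem_filter, Finset.mem_product]; exact ⟨⟨hi, hj⟩, hip, hex⟩, ?_⟩
    have hg : i * g (i, j) * j = p * g (i, j) * q := by
      simp only [g, dif_pos hex]; exact hex.choose_spec
    rw [Set.mem_smul_set_iff_inv_smul_mem, smul_eq_mul, SetLike.mem_coe,
      Subgroup.mem_centralizer_singleton_iff]
    generalize g (i, j) = y at hg
    have e1 : x * (j * q⁻¹) * x⁻¹ = i⁻¹ * p := by
      have : x * j = i⁻¹ * (p * x * q) := by rw [← hij]; group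
      rw [← mul_assoc, this]; group
    have e2 : y * (j * q⁻¹) * y⁻¹ = i⁻¹ * p := by
      have : y * j = i⁻¹ * (p * y * q) := by rw [← hg]; group
      rw [← mul_assoc, this]; group
    have e3 : x * (j * q⁻¹) = i⁻¹ * p * x := by rw [← e1]; group
    have e4 : (j * q⁻¹) * y⁻¹ = y⁻¹ * (i⁻¹ * p) := by rw [← e2]; group
    rw [mul_assoc, e3, ← mul_assoc (j * q⁻¹), e4]; group
  obtain ⟨ij, hij, hfin⟩ := Subgroup.exists_finiteIndex_of_leftCoset_cover hcov
  have h1 := hK _ hfin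
  simp only [s, Finset.mem_filter] at hij
  obtain ⟨-, hne, x, hx⟩ := hij
  rw [mul_inv_eq_one.1 h1] at hx
  exact hne (mul_right_cancel (mul_right_cancel hx))

/-- The radical is nilpotent, hence zero by primeness, so the ring is semisimple and the
augmentation ideal has a complement. A nonzero element of the complement is fixed by left
multiplication by `K`, so its coefficients are constant and its finite support is all of `K`. -/
theorem finite_of_isArtinianRing_of_icc [IsArtinianRing (MonoidAlgebra F K)]
    (hK : ∀ k : K, (Subgroup.centralizer {k}).FiniteIndex → k = 1) : Finite K := by
  by_contra hinf
  rw [not_finite_iff_infinite] at hinf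
  have hJ : Ring.jacobson (MonoidAlgebra F K) = ⊥ := by
    classical
    set J : Ideal (MonoidAlgebra F K) := Ring.jacobson (MonoidAlgebra F K)
    have hnil : ∃ n : ℕ, J ^ n = 0 := IsSemiprimaryRing.isNilpotent
    obtain ⟨m, hm⟩ : ∃ m, Nat.find hnil = m + 1 := by
      refine Nat.exists_eq_succ_of_ne_zero fun h0 => ?_
      have h1 := Nat.find_spec hnil
      rw [h0, Submodule.pow_zero, Ideal.one_eq_top] at h1
      exact top_ne_bot h1
    have hs := Nat.find_spec hnil
    rw [hm, Submodule.pow_succ] at hs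
    -- `J ^ m` is the last nonzero power, so `a x b = 0` for `a ∈ J ^ m`, `b ∈ J` and every `x`.
    obtain ⟨a, ha, ha0⟩ := Submodule.exists_mem_ne_zero_of_ne_bot
      (Nat.find_min hnil (m := m) (by omega))
    refine (Submodule.eq_bot_iff _).2 fun b hb => ?_
    refine (eq_zero_or_eq_zero_of_forall_mul_mul hK fun x => ?_).resolve_left ha0
    rw [mul_assoc]
    exact (Submodule.mem_bot _).1 (hs.le (Ideal.mul_mem_mul ha (Ideal.mul_mem_left _ _ hb)))
  have hss : IsSemisimpleRing (MonoidAlgebra F K) :=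
    IsArtinianRing.isSemisimpleRing_iff_jacobson.2 hJ
  obtain ⟨M, hM⟩ := exists_isCompl (subgroupIdeal F (⊤ : Subgroup K))
  have hM0 : M ≠ ⊥ := by
    rintro rfl
    have h1 : (1 : MonoidAlgebra F K) ∈ subgroupIdeal F (⊤ : Subgroup K) := by
      rw [← sup_bot_eq (subgroupIdeal F (⊤ : Subgroup K)), hM.sup_eq_top]
      trivial
    have h2 := cosetSum_eq_zero h1
    rw [one_def, cosetSum_single, Finsupp.single_eq_zero] at h2
    exact one_ne_zero h2
  obtain ⟨m, hm, hm0⟩ := Submodule.exists_mem_ne_zero_of_ne_bot hM0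
  have hfix : ∀ k : K, single k 1 * m = m := by
    intro k
    -- The left ideal for `⊤` is two-sided: `(k - 1) g = g (g⁻¹ k g - 1)`.
    have h1 : (single k 1 - 1) * m ∈ subgroupIdeal F (⊤ : Subgroup K) := by
      clear hm hm0
      induction m using MonoidAlgebra.induction_linear with
      | zero => simp
      | add a b ha hb => rw [mul_add]; exact add_mem ha hb
      | single g c =>
        have : (single k 1 - 1) * single g c =
            single g c * (single (g⁻¹ * k * g) (1 : F) - 1) := by
          simp [mul_sub, sub_mul, single_mul_single, mul_assoc]
        rw [this]
        exact Ideal.mul_mem_left _ _ (Ideal.subset_span ⟨_, trivial, rfl⟩)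
    have h2 : (single k 1 - 1) * m ∈ (⊥ : Ideal (MonoidAlgebra F K)) := by
      rw [← hM.inf_eq_bot]
      exact ⟨h1, Ideal.mul_mem_left _ _ hm⟩
    rwa [Submodule.mem_bot, sub_mul, one_mul, sub_eq_zero] at h2
  obtain ⟨g, hg⟩ : ∃ g, m.coeff g ≠ 0 := by
    by_contra! h0; exact hm0 (by ext k; simpa using h0 k)
  refine Set.infinite_univ (α := K) (m.coeff.support.finite_toSet.subset fun k _ => ?_)
  rw [Finset.mem_coe, Finsupp.mem_support_iff]
  have h1 := congrArg (fun s => s.coeff k) (hfix (k * g⁻¹))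
  simp only [coeff_single_mul_apply, one_mul, mul_inv_rev, inv_inv, inv_mul_cancel_right] at h1
  rwa [← h1]

end Prime

/-! ### Connell's theorem over prime fields -/

section Finite

variable {K : Type*} [Group K]

/-- The ascending condition gives finite generation, the descending one gives torsion. -/
theorem finite_of_wellFounded_subgroup {Z : Type*} [CommGroup Z] [WellFoundedLT (Subgroup Z)]
    [WellFoundedGT (Subgroup Z)] : Finite Z := by
  have hfg : Group.FG Z := by
    obtain ⟨U, hU, hmax⟩ := (wellFounded_gt (α := Subgroup Z)).has_min {U | U.FG} ⟨⊥, Subgroup.FG.bot⟩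
    have : U = ⊤ := by
      refine (Subgroup.eq_top_iff' U).2 fun z => ?_
      have h1 : (U ⊔ Subgroup.closure {z}).FG :=
        hU.sup ⟨{z}, by simp⟩
      have h2 := hmax _ h1
      have h3 : U = U ⊔ Subgroup.closure {z} := eq_of_le_of_not_lt le_sup_left h2
      rw [h3]
      exact Subgroup.mem_sup_right (Subgroup.subset_closure rfl)
    exact ⟨this ▸ hU⟩
  refine CommGroup.finite_of_fg_isMulTorsion Z fun z => ?_
  obtain ⟨_, ⟨n, hn, rfl⟩, hmin⟩ := (wellFounded_lt (α := Subgroup Z)).has_min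
    {U | ∃ n : ℤ, n ≠ 0 ∧ U = Subgroup.zpowers (z ^ n)} ⟨_, 1, one_ne_zero, rfl⟩
  -- By minimality `z ^ n` and `z ^ (2 n)` generate the same subgroup, so `z ^ (n (2 k - 1)) = 1`
  -- for some `k`, with a nonzero exponent since `2 k - 1` is odd.
  have h1 := hmin _ ⟨2 * n, by simp [hn], rfl⟩
  have h2 : Subgroup.zpowers (z ^ (2 * n)) = Subgroup.zpowers (z ^ n) := by
    refine eq_of_le_of_not_lt ?_ h1
    rw [Subgroup.zpowers_le]
    exact ⟨2, by rw [mul_comm, zpow_mul]⟩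
  have h3 := h2.ge (Subgroup.mem_zpowers _)
  obtain ⟨k, hk⟩ := h3
  refine isOfFinOrder_iff_zpow_eq_one.2 ⟨2 * n * k - n, ?_, ?_⟩
  · have : 2 * n * k - n = n * (2 * k - 1) := by ring
    rw [this]
    exact mul_ne_zero hn (by omega)
  · simp only [← zpow_mul] at hk
    rw [zpow_sub, hk, mul_inv_cancel]

/-- Connell's theorem over a field in which every element is a quotient of integers. -/
theorem finite_of_isArtinianRing {F : Type*} [Field F]
    (hF : ∀ c : F, ∃ n m : ℤ, (n : F) ≠ 0 ∧ n * c = m) [IsArtinianRing (MonoidAlgebra F K)] :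
    Finite K := by
  classical
  have := wellFoundedLT_subgroup (K := K) F
  have := wellFoundedGT_subgroup (K := K) F
  -- A minimal subgroup of finite index has no proper subgroup of finite index. Its center is finite
  -- by the chain conditions, so it is enough that `K₀` modulo its center is finite.
  obtain ⟨K₀, hK₀, hmin⟩ := (wellFounded_lt (α := Subgroup K)).has_min {U | U.FiniteIndex}
    ⟨⊤, inferInstanceAs (Subgroup.FiniteIndex ⊤)⟩
  have hK₀' : K₀.FiniteIndex := hK₀
  have hno : ∀ W : Subgroup K₀, W.FiniteIndex → W = ⊤ := by
    intro W hW
    have h1 : (W.map K₀.subtype).FiniteIndex :=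
      ⟨by rw [Subgroup.index_map_subtype]; exact mul_ne_zero hW.index_ne_zero hK₀.index_ne_zero⟩
    have h2 : W.map K₀.subtype = K₀ :=
      eq_of_le_of_not_lt (Subgroup.map_subtype_le W) (hmin _ h1)
    refine (Subgroup.eq_top_iff' W).2 fun k => ?_
    obtain ⟨k', hk', h⟩ := h2.ge k.2
    rwa [← Subtype.ext h]
  let j : Subgroup (Subgroup.center K₀) → Subgroup K := fun U =>
    (U.map (Subgroup.center K₀).subtype).map K₀.subtype
  have hj : StrictMono j := by
    refine Monotone.strictMono_of_injective
      (fun _ _ h => Subgroup.map_mono (Subgroup.map_mono h)) ?_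
    exact (Subgroup.map_injective K₀.subtype_injective).comp
      (Subgroup.map_injective (Subgroup.center K₀).subtype_injective)
  have := hj.wellFoundedLT
  have := hj.wellFoundedGT
  have hZ : Finite (Subgroup.center K₀) :=
    letI : CommGroup (Subgroup.center K₀) :=
      { (inferInstance : Group (Subgroup.center K₀)) with
        mul_comm := fun a b => Subtype.ext (b.2.comm a).symm.eq }
    finite_of_wellFounded_subgroup
  have hicc : ∀ k : K₀ ⧸ Subgroup.center K₀, (Subgroup.centralizer {k}).FiniteIndex → k = 1 := by
    intro k hk
    obtain ⟨z, rfl⟩ := QuotientGroup.mk_surjective k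
    have h1 := hno ((Subgroup.centralizer {(z : K₀ ⧸ Subgroup.center K₀)}).comap
      (QuotientGroup.mk' _)) ⟨by
        rw [Subgroup.index_comap_of_surjective _ (QuotientGroup.mk'_surjective _)]
        exact hk.index_ne_zero⟩
    have h2 : ∀ g : K₀, g * z * g⁻¹ * z⁻¹ ∈ Subgroup.center K₀ := by
      intro g
      have h3 : g ∈ (Subgroup.centralizer {(z : K₀ ⧸ Subgroup.center K₀)}).comap
        (QuotientGroup.mk' _) := h1 ▸ Subgroup.mem_top g
      rw [Subgroup.mem_comap, Subgroup.mem_centralizer_singleton_iff] at h3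
      rw [← QuotientGroup.eq_one_iff]
      change (g : K₀ ⧸ Subgroup.center K₀) * z = z * g at h3
      change (g : K₀ ⧸ Subgroup.center K₀) * z * (g : K₀ ⧸ Subgroup.center K₀)⁻¹ *
        (z : K₀ ⧸ Subgroup.center K₀)⁻¹ = 1
      rw [h3]
      group
    -- The commutators with `z` are central, so `g ↦ g z g⁻¹ z⁻¹` is a homomorphism into a finite
    -- group. Its kernel has finite index, hence is all of `K₀`, and `z` is central.
    let f : K₀ →* Subgroup.center K₀ := MonoidHom.mk' (fun g => ⟨_, h2 g⟩) fun g h => by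
      refine Subtype.ext ?_
      change g * h * z * (g * h)⁻¹ * z⁻¹ = (g * z * g⁻¹ * z⁻¹) * (h * z * h⁻¹ * z⁻¹)
      have h3 := Subgroup.mem_center_iff.1 (h2 h) (g * z * g⁻¹ * z⁻¹)
      rw [h3]
      have h4 := Subgroup.mem_center_iff.1 (h2 h) g
      calc g * h * z * (g * h)⁻¹ * z⁻¹ = g * (h * z * h⁻¹ * z⁻¹) * (z * g⁻¹ * z⁻¹) := by group
        _ = _ := by rw [h4]; group
    have hker := hno f.ker inferInstance
    rw [QuotientGroup.eq_one_iff, Subgroup.mem_center_iff]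
    intro g
    have h3 : g ∈ f.ker := hker ▸ Subgroup.mem_top g
    have h4 : g * z * g⁻¹ * z⁻¹ = 1 := congrArg Subtype.val (MonoidHom.mem_ker.1 h3)
    rw [mul_inv_eq_one, mul_inv_eq_iff_eq_mul] at h4
    exact h4
  -- Discard the coefficients outside `K₀`, then project. The section `q ↦ q.out` is not
  -- multiplicative, which the retraction lemma does not require.
  let E : MonoidAlgebra F K →+ MonoidAlgebra F (K₀ ⧸ Subgroup.center K₀) :=
    (Finsupp.liftAddHom fun k => if h : k ∈ K₀ then
      singleAddHom (QuotientGroup.mk (⟨k, h⟩ : K₀)) else 0).comp coeffAddEquiv.toAddMonoidHom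
  have hEmem : ∀ (k : K₀) c, E (single (k : K) c) = single (k : K₀ ⧸ Subgroup.center K₀) c := by
    intro k c
    simp [E]
  have hEnot : ∀ k ∉ K₀, ∀ c, E (single (k : K) c) = 0 := by
    intro k hk c
    simp [E, hk]
  have : IsArtinianRing (MonoidAlgebra F (K₀ ⧸ Subgroup.center K₀)) := by
    refine isArtinianRing_of_retraction hF (S := MonoidAlgebra F K)
      (fun q => single ((q.out : K₀) : K) 1) E ?_ ?_
    · intro s q
      induction s using MonoidAlgebra.induction_linear with
      | zero => simp
      | add a b ha hb => rw [add_mul, map_add, map_add, ha, hb, add_mul]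
      | single k c =>
        rw [single_mul_single]
        by_cases hk : k ∈ K₀
        · have h1 := hEmem (⟨k, hk⟩ * q.out) (c * 1)
          have h2 := hEmem ⟨k, hk⟩ c
          simp only [Subgroup.coe_mul] at h1 h2
          rw [h1, h2, single_mul_single, QuotientGroup.mk_mul, QuotientGroup.out_eq']
        · rw [hEnot k hk, hEnot _ (fun h => hk ?_), zero_mul]
          exact (Subgroup.mul_mem_cancel_right _ (SetLike.coe_mem _)).1 h
    · intro q
      rw [hEmem, QuotientGroup.out_eq']
  have := finite_of_isArtinianRing_of_icc (F := F) hicc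
  have : Finite K₀ := Finite.of_equiv _ (Subgroup.groupEquivQuotientProdSubgroup
    (s := Subgroup.center K₀)).symm
  have : Finite (K ⧸ K₀) := Subgroup.finite_quotient_of_finiteIndex
  exact Finite.of_equiv _ (Subgroup.groupEquivQuotientProdSubgroup (s := K₀)).symm

end Finite

end MonoidAlgebra

/-! ### Additive functionals into prime fields -/

theorem exists_addMonoidHom_eq_one (K : Type*) {V : Type*} [Field K] [AddCommGroup V] [Module K V]
    {v : V} (hv : v ≠ 0) : ∃ φ : V →+ K, φ v = 1 := by
  obtain ⟨φ, hφ⟩ : ∃ φ : Module.Dual K V, φ v ≠ 0 := by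
    by_contra! h
    exact hv ((Module.forall_dual_apply_eq_zero_iff K _).1 h)
  exact ⟨((φ v)⁻¹ • φ).toAddMonoidHom, inv_mul_cancel₀ hφ⟩

/-- A nonzero idempotent is mapped to `1` by some additive map into a prime field. -/
theorem exists_addMonoidHom_field_of_idempotent {A : Type*} [Ring A] {f : A} (hf : f ≠ 0)
    (hff : f * f = f) : ∃ (F : Type) (_ : Field F),
      (∀ c : F, ∃ n m : ℤ, (n : F) ≠ 0 ∧ n * c = m) ∧ ∃ φ : A →+ F, φ f = 1 := by
  by_cases ho : addOrderOf f = 0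
  · refine ⟨ℚ, inferInstance, fun c => ⟨c.den, c.num, by simp, by simp [Rat.den_mul_eq_num]⟩, ?_⟩
    have hinj : Function.Injective (LinearMap.toSpanSingleton ℤ A f) := by
      intro a b hab
      simp only [LinearMap.toSpanSingleton_apply] at hab
      by_contra hne
      have h1 : (a - b) • f = 0 := by rw [sub_smul, hab, sub_self]
      have h2 : IsOfFinAddOrder f :=
        isOfFinAddOrder_iff_zsmul_eq_zero.2 ⟨a - b, sub_ne_zero.2 hne, h1⟩
      exact addOrderOf_eq_zero_iff.1 ho h2
    -- Infinite additive order: the map `f ↦ 1` on `ℤ f` extends to `A` because the divisible group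
    -- `ℚ` is injective.
    have hb : Module.Baer ℤ ℚ := Module.Baer.of_divisible _
    obtain ⟨h, hh⟩ := hb.extension_property (LinearMap.toSpanSingleton ℤ A f) hinj
      (LinearMap.toSpanSingleton ℤ ℚ 1)
    refine ⟨h.toAddMonoidHom, ?_⟩
    simpa using LinearMap.congr_fun hh 1
  · have h1 : addOrderOf f ≠ 1 := by simpa using hf
    obtain ⟨p, hp, m, hm⟩ := Nat.exists_prime_and_dvd h1
    have : Fact p.Prime := ⟨hp⟩
    refine ⟨ZMod p, inferInstance, fun c => ⟨1, c.val, by simp, by simp⟩, ?_⟩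
    let pA : AddSubgroup A := (nsmulAddMonoidHom p : A →+ A).range
    -- If `f = p a`, then `m f = m f² = a (m p f) = 0`, although `m` is smaller than the order `p m`
    -- of `f`. So `f` survives in the `ZMod p`-vector space `A / pA`.
    have hfp : f ∉ pA := by
      rintro ⟨a, ha⟩
      change p • a = f at ha
      have h2 : m • f = 0 := by
        rw [← hff, ← smul_mul_assoc]
        nth_rw 1 [← ha]
        rw [smul_smul, mul_comm m, ← hm, smul_mul_assoc, ← mul_smul_comm, addOrderOf_nsmul_eq_zero,
          mul_zero]
      have h3 := Nat.le_of_dvd (Nat.pos_of_ne_zero fun h => ho (by rw [hm, h, mul_zero]))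
        (addOrderOf_dvd_of_nsmul_eq_zero h2)
      have h4 := hp.two_le
      have h5 : m ≠ 0 := fun h => ho (by rw [hm, h, mul_zero])
      have h6 : 0 < m := Nat.pos_of_ne_zero h5
      nlinarith
    let _ : Module (ZMod p) (A ⧸ pA) := AddCommGroup.zmodModule fun x => by
      obtain ⟨a, rfl⟩ := QuotientAddGroup.mk_surjective x
      exact (QuotientAddGroup.eq_zero_iff (p • a)).2 ⟨a, rfl⟩
    obtain ⟨φ, hφ⟩ := exists_addMonoidHom_eq_one (ZMod p) (v := (f : A ⧸ pA))
      (fun h => hfp ((QuotientAddGroup.eq_zero_iff f).1 h))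
    exact ⟨φ.comp (QuotientAddGroup.mk' pA), hφ⟩

/-! ### Central idempotents under the artinian condition -/

/-- A central idempotent. -/
def IsCentralIdempotent {A : Type*} [Mul A] (e : A) : Prop := e * e = e ∧ ∀ a, e * a = a * e

namespace IsCentralIdempotent

variable {A : Type*} [Ring A] {e f : A}

theorem mul (he : IsCentralIdempotent e) (hf : IsCentralIdempotent f) :
    IsCentralIdempotent (e * f) := by
  refine ⟨?_, fun a => ?_⟩
  · rw [mul_assoc, ← mul_assoc f, hf.2 e, mul_assoc e f f, hf.1, ← mul_assoc, he.1]
  · rw [mul_assoc, hf.2, ← mul_assoc, he.2, mul_assoc]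

theorem one_sub (he : IsCentralIdempotent e) : IsCentralIdempotent (1 - e) :=
  ⟨by rw [mul_sub, sub_mul, sub_mul, he.1]; simp, fun a => by rw [mul_sub, sub_mul, he.2]; simp⟩

theorem isArtinianRing_minimal [IsArtinianRing A] (C : Set A) (hC : ∀ e ∈ C, IsCentralIdempotent e)
    (hne : C.Nonempty) : ∃ e ∈ C, ∀ e' ∈ C, e' * e = e' → e' = e := by
  obtain ⟨e₀, he₀⟩ := hne
  obtain ⟨_, ⟨e, he, rfl⟩, hmin⟩ := (wellFounded_lt (α := Ideal A)).has_min
    ((fun e => Ideal.span {e}) '' C) ⟨_, e₀, he₀, rfl⟩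
  refine ⟨e, he, fun e' he' h => ?_⟩
  have hle : Ideal.span {e'} ≤ Ideal.span {e} := by
    rw [Ideal.span_singleton_le_iff_mem, Ideal.mem_span_singleton']
    exact ⟨e', h⟩
  have h1 := eq_of_le_of_not_lt hle (hmin _ ⟨e', he', rfl⟩)
  have h2 : e ∈ Ideal.span {e'} := h1 ▸ Ideal.mem_span_singleton_self e
  obtain ⟨a, ha⟩ := Ideal.mem_span_singleton'.1 h2
  rw [← h, (hC _ he').2, ← ha, mul_assoc, (hC _ he').1]

theorem isArtinianRing_op_minimal [IsArtinianRing Aᵐᵒᵖ] (C : Set A)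
    (hC : ∀ e ∈ C, IsCentralIdempotent e) (hne : C.Nonempty) :
    ∃ e ∈ C, ∀ e' ∈ C, e' * e = e' → e' = e := by
  obtain ⟨e, he, hmin⟩ := isArtinianRing_minimal (A := Aᵐᵒᵖ) (MulOpposite.unop ⁻¹' C)
    (fun e he => ⟨MulOpposite.unop_injective (hC _ he).1,
      fun a => MulOpposite.unop_injective ((hC _ he).2 _).symm⟩)
    (hne.preimage MulOpposite.unop_surjective)
  refine ⟨e.unop, he, fun e' he' h => ?_⟩
  have := hmin (MulOpposite.op e') he' (MulOpposite.unop_injective (by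
    change e.unop * e' = e'
    rw [(hC _ he).2, h]))
  rw [← this]
  rfl

/-- Given infinitely many indices with `c h ≠ 0`, some primitive central idempotent lies below
infinitely many of the `c h`. -/
theorem exists_primitive
    (hA : ∀ C : Set A, (∀ e ∈ C, IsCentralIdempotent e) → C.Nonempty →
      ∃ e ∈ C, ∀ e' ∈ C, e' * e = e' → e' = e)
    {X : Type*} (c : X → A) (hc : ∀ h, IsCentralIdempotent (c h))
    (hinf : {h | c h ≠ 0}.Infinite) :
    ∃ e, IsCentralIdempotent e ∧ e ≠ 0 ∧ (∀ f, IsCentralIdempotent f → e * f = e ∨ e * f = 0) ∧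
      {h | e * c h = e}.Infinite := by
  obtain ⟨e, ⟨he, hei⟩, hmin⟩ := hA {e | IsCentralIdempotent e ∧ {h | e * c h ≠ 0}.Infinite}
    (fun e he => he.1) ⟨1, ⟨by simp, by simp⟩, by simpa using hinf⟩
  have hprim : ∀ f, IsCentralIdempotent f → e * f = e ∨ e * f = 0 := by
    intro f hf
    -- Since `e = e f + e (1 - f)`, one of the two summands still meets infinitely many `c h`; by
    -- minimality it equals `e`.
    have hsub : {h | e * c h ≠ 0} ⊆ {h | e * f * c h ≠ 0} ∪ {h | e * (1 - f) * c h ≠ 0} := by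
      intro h hh
      by_contra hcon
      simp only [Set.mem_union, Set.mem_ofPred_eq, not_or, not_not] at hcon
      refine hh ?_
      have : e * c h = e * f * c h + e * (1 - f) * c h := by noncomm_ring
      rw [this, hcon.1, hcon.2, add_zero]
    have hcomm : ∀ g : A, IsCentralIdempotent g → e * g * e = e * g := fun g hg => by
      rw [mul_assoc, hg.2, ← mul_assoc, he.1]
    rcases Set.infinite_union.1 (hei.mono hsub) with h | h
    · exact Or.inl (hmin _ ⟨he.mul hf, h⟩ (hcomm f hf))
    · right
      have := hmin _ ⟨he.mul hf.one_sub, h⟩ (hcomm _ hf.one_sub)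
      rw [mul_sub, mul_one] at this
      simpa using this
  refine ⟨e, he, ?_, hprim, hei.mono fun h hh => (hprim _ (hc h)).resolve_right hh⟩
  rintro rfl
  simp at hei

end IsCentralIdempotent

/-! ### Infinite stabilizers in the isotropy group -/

namespace GroupoidPartialAction

variable {G : Type u} [Groupoid.{v} G] {A : Type w} [Ring A] {α : GroupoidPartialAction G A}

theorem IsUnital.one_isCentralIdempotent (hα : α.IsUnital) {y z : G} (g : y ⟶ z) :
    IsCentralIdempotent (hα.one g) := ⟨hα.one_mul_one g, hα.one_comm g⟩

/-- Only `a 1_g` matters in a product of `a` with an element of `A_g`, and `a 1_g` is itself a value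
of `α_g`. -/
theorem IsUnital.act_isCentralIdempotent (hα : α.IsUnital) {y z : G} (g : y ⟶ z) {e : A}
    (he : IsCentralIdempotent e) : IsCentralIdempotent (hα.act g e) := by
  refine ⟨by rw [← map_mul, he.1], fun a => ?_⟩
  have h1 : hα.act g e * hα.one g = hα.act g e := (hα.mem_iff g _).1 (hα.act_mem g e)
  obtain ⟨b, -, hb⟩ := hα.exists_act_eq g (hα.mul_mem_left g a (hα.one_mem g))
  rw [← h1, mul_assoc, hα.one_comm, ← hb, ← map_mul, he.2, map_mul, hb, mul_assoc,
    hα.one_comm, h1]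

theorem dom_ne_bot_iff (hα : α.IsUnital) {y z : G} (g : y ⟶ z) : α.dom g ≠ ⊥ ↔ hα.one g ≠ 0 := by
  rw [not_iff_not]
  constructor
  · intro h
    have := hα.one_mem g
    rw [h] at this
    exact NonUnitalSubring.mem_bot.1 this
  · intro h
    refine (eq_bot_iff).2 fun a ha => ?_
    rw [hα.mem_iff, h, mul_zero] at ha
    exact NonUnitalSubring.mem_bot.2 ha.symm

/-- The stabilizer of an element `f` with respect to a partial action of an isotropy group. -/
def stabilizer (hα : α.IsUnital) {x : G} (f : A) (hf : f ∈ α.dom (𝟙 x)) : Subgroup (End x) where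
  carrier := {k | f ∈ α.dom (Groupoid.inv k) ∧ hα.act k f = f}
  one_mem' := by
    refine ⟨?_, ?_⟩
    · change f ∈ α.dom (Groupoid.inv (𝟙 x))
      rwa [show Groupoid.inv (𝟙 x) = 𝟙 x by simp]
    · exact (hα.act_id x f).trans ((hα.mem_iff _ _).1 hf)
  mul_mem' := by
    rintro g h ⟨hg, hg'⟩ ⟨hh, hh'⟩
    have := hα.act_comp h g hh (by rwa [hh'])
    exact ⟨this.1, this.2.trans (by rw [hh', hg'])⟩
  inv_mem' := by
    rintro k ⟨hk, hk'⟩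
    have hm : f ∈ α.dom k := hk' ▸ hα.act_mem k f
    refine ⟨?_, ?_⟩
    · change f ∈ α.dom (Groupoid.inv (Groupoid.inv k))
      rwa [show Groupoid.inv (Groupoid.inv k) = k by simp]
    · have := hα.act_act_inv (Groupoid.inv k) (b := f) hk
      rw [show Groupoid.inv (Groupoid.inv k) = k by simp, hk'] at this
      exact this

theorem mem_stabilizer (hα : α.IsUnital) {x : G} {f : A} {hf : f ∈ α.dom (𝟙 x)} {k : End x} :
    k ∈ stabilizer hα f hf ↔ f ∈ α.dom (Groupoid.inv k) ∧ hα.act k f = f := Iff.rfl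

/-- A primitive `e` lies below infinitely many `1_h`, and a primitive `f` lies below infinitely many
of the corresponding `α_{h⁻¹}(e)`. For these `h`, `α_h(f)` is a nonzero central idempotent below
`e`, hence equal to `e`. Two such arrows `h₀, h` therefore give `h₀⁻¹ h` fixing `f`. -/
theorem exists_infinite_stabilizer (hα : α.IsUnital) {x : G}
    (hA : ∀ C : Set A, (∀ e ∈ C, IsCentralIdempotent e) → C.Nonempty →
      ∃ e ∈ C, ∀ e' ∈ C, e' * e = e' → e' = e)
    (hinf : ¬ {h : x ⟶ x | α.dom h ≠ ⊥}.Finite) :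
    ∃ (f : A) (hf : f ∈ α.dom (𝟙 x)), IsCentralIdempotent f ∧ f ≠ 0 ∧
      Infinite (stabilizer hα f hf) := by
  classical
  obtain ⟨e, he, he0, hep, hei⟩ := IsCentralIdempotent.exists_primitive hA
    (fun h : x ⟶ x => hα.one h) (fun h => hα.one_isCentralIdempotent h)
    (by simpa only [dom_ne_bot_iff hα, Set.not_finite] using hinf)
  -- The value `0` excludes the `h` with `e` not below `1_h`; for the others `α_{h⁻¹}(e) ≠ 0`.
  obtain ⟨f, hf, hf0, -, hfi⟩ := IsCentralIdempotent.exists_primitive hA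
    (fun h : x ⟶ x => if e * hα.one h = e then hα.act (Groupoid.inv h) e else 0) (fun h => by
      split_ifs
      · exact hα.act_isCentralIdempotent _ he
      · exact ⟨by simp, by simp⟩) (hei.mono fun h hh => by
      simp only [Set.mem_ofPred_eq] at hh ⊢
      rw [if_pos hh]
      intro h0
      have := hα.act_act_inv h ((hα.mem_iff h e).2 hh)
      rw [h0, map_zero] at this
      exact he0 this.symm)
  have key : ∀ h ∈ {h : x ⟶ x | f * (if e * hα.one h = e then hα.act (Groupoid.inv h) e else 0) = f},
      e ∈ α.dom h ∧ f ∈ α.dom (Groupoid.inv h) ∧ hα.act h f = e := by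
    intro h hh
    simp only [Set.mem_ofPred_eq] at hh
    by_cases heh : e * hα.one h = e
    · rw [if_pos heh] at hh
      have he' : e ∈ α.dom h := (hα.mem_iff h e).2 heh
      have hfm : f ∈ α.dom (Groupoid.inv h) := hh ▸ hα.mul_mem_left _ _ (hα.act_mem _ _)
      refine ⟨he', hfm, ?_⟩
      have h1 : hα.act h f * e = hα.act h f := by
        conv_rhs => rw [← hh, map_mul, hα.act_act_inv h he']
      have h2 : hα.act h f ≠ 0 := by
        intro h0
        have := hα.act_act_inv (Groupoid.inv h) (b := f) hfm
        rw [show Groupoid.inv (Groupoid.inv h) = h by simp, h0, map_zero] at this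
        exact hf0 this.symm
      have h3 := hep _ (hα.act_isCentralIdempotent h hf)
      rw [he.2, h1] at h3
      exact h3.resolve_right h2
    · rw [if_neg heh, mul_zero] at hh
      exact absurd hh.symm hf0
  set T := {h : x ⟶ x | f * (if e * hα.one h = e then hα.act (Groupoid.inv h) e else 0) = f}
  obtain ⟨h₀, hh₀⟩ := hfi.nonempty
  obtain ⟨k1, k2, k3⟩ := key _ hh₀
  refine ⟨f, α.dom_le _ k2, hf, hf0, ?_⟩
  have : Infinite T := hfi.to_subtype
  let j : T → End x := Subtype.val
  let h₁ : End x := h₀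
  have hj : ∀ h : T, h₁⁻¹ * j h ∈ stabilizer hα f (α.dom_le _ k2) := by
    intro h
    obtain ⟨l1, l2, l3⟩ := key _ h.2
    rw [mem_stabilizer]
    have := hα.act_comp (h : x ⟶ x) (Groupoid.inv h₀) l2
      (by rwa [l3, show Groupoid.inv (Groupoid.inv h₀) = h₀ by simp])
    refine ⟨this.1, Eq.trans this.2 ?_⟩
    rw [l3, ← k3]
    have h4 := hα.act_act_inv (Groupoid.inv h₀) (b := f) k2
    rwa [show Groupoid.inv (Groupoid.inv h₀) = h₀ by simp] at h4
  refine Infinite.of_injective (β := T) (fun h => (⟨_, hj h⟩ : stabilizer hα f _)) ?_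
  intro h h' hh
  exact Subtype.ext (mul_left_cancel (G := End x) (a := h₁⁻¹) (b := j h) (c := j h') (congrArg Subtype.val hh))

end GroupoidPartialAction

/-! ### The skew ring over its coefficient ring -/

theorem IsArtinianRing.of_closure_eq_top {P S : Type*} [Ring P] [Ring S] (ψ : P →+* S) {W : Set S}
    (hW : W.Finite) (h : AddSubgroup.closure {t | ∃ p, ∃ w ∈ W, t = ψ p * w} = ⊤)
    [IsArtinianRing P] : IsArtinianRing S := by
  let _ : Module P S := Module.compHom S ψ
  have hsmul : ∀ (p : P) (s : S), p • s = ψ p * s := fun _ _ => rfl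
  have : IsScalarTower P S S := ⟨fun p s t => by simp only [hsmul, smul_eq_mul, mul_assoc]⟩
  have hspan : Submodule.span P W = ⊤ := by
    refine Submodule.toAddSubgroup_injective (top_le_iff.1 ?_)
    rw [← h, AddSubgroup.closure_le]
    rintro _ ⟨p, w, hw, rfl⟩
    exact Submodule.smul_mem _ p (Submodule.subset_span hw)
  have : Module.Finite P S := ⟨⟨hW.toFinset, by simpa using hspan⟩⟩
  exact isArtinian_of_tower P inferInstance

namespace GroupoidPartialAction

variable {G : Type u} [Groupoid.{v} G] {A : Type w} [Ring A] {α : GroupoidPartialAction G A}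

theorem IsDirectSumOfObjects.one_mul_eq_zero (hsum : α.IsDirectSumOfObjects) (hα : α.IsUnital)
    {y z : G} (hyz : y ≠ z) {a : A} (ha : a ∈ α.dom (𝟙 z)) : hα.one (𝟙 y) * a = 0 := by
  classical
  have hind := DirectSum.IsInternal.addSubgroup_iSupIndep hsum
  have hdis := hind.pairwiseDisjoint hyz
  have h1 : hα.one (𝟙 y) * a ∈ (α.dom (𝟙 y)).toAddSubgroup :=
    hα.mul_mem_right _ _ (hα.one_mem _)
  have h2 : hα.one (𝟙 y) * a ∈ (α.dom (𝟙 z)).toAddSubgroup := hα.mul_mem_left _ _ ha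
  exact AddSubgroup.disjoint_def.1 hdis h1 h2

theorem IsDirectSumOfObjects.sum_one [Fintype G] (hsum : α.IsDirectSumOfObjects)
    (hα : α.IsUnital) : ∑ y : G, hα.one (𝟙 y) = 1 := by
  classical
  have key : ∀ a : A, (∑ y : G, hα.one (𝟙 y)) * a = a := by
    intro a
    have htop : a ∈ ⨆ y : G, (α.dom (𝟙 y)).toAddSubgroup := by
      obtain ⟨s, rfl⟩ := hsum.2 a
      induction s using DirectSum.induction_on with
      | zero => rw [map_zero]; exact zero_mem _
      | of y b =>
        rw [DirectSum.coeAddMonoidHom_of]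
        exact AddSubgroup.mem_iSup_of_mem y b.2
      | add s t hs ht => rw [map_add]; exact add_mem hs ht
    refine AddSubgroup.iSup_induction (C := fun a => (∑ y : G, hα.one (𝟙 y)) * a = a) _ htop
      ?_ (mul_zero _) fun a b ha hb => by rw [mul_add, ha, hb]
    intro z a ha
    rw [Finset.sum_mul, Finset.sum_eq_single z]
    · rw [hα.one_comm]
      exact (hα.mem_iff _ _).1 ha
    · intro y _ hy
      exact hsum.one_mul_eq_zero hα hy ha
    · simp
  simpa using key 1

namespace SkewRing

variable (hα : α.IsUnital)

variable {hα} in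
theorem induction {p : SkewRing α hα → Prop} (s : SkewRing α hα) (zero : p 0)
    (add : ∀ s t, p s → p t → p (s + t)) (single : ∀ g a, p (single hα g a)) : p s := by
  classical
  exact DirectSum.induction_on s zero single add

open Classical in
/-- The additive map that applies `c i` to the coefficient of the arrow `ι i`, and sums. -/
noncomputable def sumAlong {I R : Type*} [AddCommMonoid R] (ι : I → Arr G) (c : I → A →+ R) :
    SkewRing α hα →+ R :=
  DirectSum.toAddMonoid fun g => if h : ∃ i, ι i = g then
    (c h.choose).comp (α.dom g.2.2).toAddSubgroup.subtype else 0

section sumAlong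

variable {I R : Type*} [AddCommMonoid R] {ι : I → Arr G} {c : I → A →+ R}

theorem sumAlong_single (hι : Function.Injective ι) (i : I) (a : α.dom (ι i).2.2) :
    sumAlong hα ι c (single hα (ι i) a) = c i a := by
  classical
  have h : ∃ j, ι j = ι i := ⟨i, rfl⟩
  refine (DirectSum.toAddMonoid_of _ _ _).trans ?_
  rw [dif_pos h, hι h.choose_spec]
  rfl

theorem sumAlong_single_of_notMem {g : Arr G} (hg : g ∉ Set.range ι) (a : α.dom g.2.2) :
    sumAlong hα ι c (single hα g a) = 0 := by
  classical
  refine (DirectSum.toAddMonoid_of _ _ _).trans ?_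
  rw [dif_neg (show ¬ ∃ i, ι i = g from hg)]
  rfl

end sumAlong

/-- The sum of the coefficients at the objects. -/
noncomputable def unitCoeff : SkewRing α hα →+ A :=
  sumAlong hα (fun y : G => (⟨y, y, 𝟙 y⟩ : Arr G)) fun _ => AddMonoidHom.id A

theorem unitCoeff_single_id (y : G) (a : α.dom (𝟙 y)) :
    unitCoeff hα (single hα ⟨y, y, 𝟙 y⟩ a) = a :=
  sumAlong_single hα (ι := fun y : G => (⟨y, y, 𝟙 y⟩ : Arr G))
    (fun _ _ h => congrArg Sigma.fst h) y a

theorem unitCoeff_single_of_notMem {g : Arr G}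
    (hg : g ∉ Set.range fun y : G => (⟨y, y, 𝟙 y⟩ : Arr G)) (a : α.dom g.2.2) :
    unitCoeff hα (single hα g a) = 0 := sumAlong_single_of_notMem hα hg a

theorem arr_injective (x : G) (K : Subgroup (End x)) :
    Function.Injective fun k : K => (⟨x, x, (k : End x)⟩ : Arr G) := by
  intro k k' h
  simp only [Sigma.mk.injEq, heq_eq_eq, true_and] at h
  exact Subtype.ext h

theorem mem_dom_of_mem_stabilizer {x : G} {f : A} {hf : f ∈ α.dom (𝟙 x)} {k : End x}
    (hk : k ∈ stabilizer hα f hf) : f ∈ α.dom k := by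
  rw [← hk.2]
  exact hα.act_mem k f

theorem single_eq_zero {g : Arr G} (hg : α.dom g.2.2 = ⊥) (a : α.dom g.2.2) :
    single hα g a = 0 := by
  have : a = 0 := Subtype.ext (NonUnitalSubring.mem_bot.1 (hg.le a.2))
  rw [this, map_zero]

section Base

variable [Finite G]

/-- The additive map underlying `base`. -/
noncomputable def baseAddHom : A →+ SkewRing α hα :=
  letI := Fintype.ofFinite G
  ∑ y : G, (single hα ⟨y, y, 𝟙 y⟩).comp
    (AddMonoidHom.mk' (fun a => ⟨a * hα.one (𝟙 y), hα.mul_mem_left _ a (hα.one_mem _)⟩)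
      fun _ _ => Subtype.ext (add_mul _ _ _))

theorem baseAddHom_apply [Fintype G] (a : A) : baseAddHom hα a = ∑ y : G, single hα ⟨y, y, 𝟙 y⟩
    ⟨a * hα.one (𝟙 y), hα.mul_mem_left _ a (hα.one_mem _)⟩ := by
  obtain rfl : Fintype.ofFinite G = ‹Fintype G› := Subsingleton.elim _ _
  exact AddMonoidHom.finsetSum_apply _ _ _

theorem baseAddHom_mul_single {y z : G} (g : y ⟶ z) (a : A) (b : α.dom g) :
    baseAddHom hα a * single hα ⟨y, z, g⟩ b =
      single hα ⟨y, z, g⟩ ⟨a * b, hα.mul_mem_left _ _ b.2⟩ := by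
  let _ := Fintype.ofFinite G
  rw [baseAddHom_apply, Finset.sum_mul, Finset.sum_eq_single z]
  · rw [single_mul_single]
    refine single_eq hα (by rw [Category.comp_id]) ?_
    change a * hα.one (𝟙 z) * hα.act (𝟙 z) b = a * b
    rw [hα.act_id, (hα.mem_iff _ _).1 (α.dom_le g b.2), mul_assoc, hα.one_comm,
      (hα.mem_iff _ _).1 (α.dom_le g b.2)]
  · intro b _ hb
    exact single_mul_single_of_ne hα (fun h => hb h.symm) _ _
  · simp

theorem single_mul_baseAddHom {y z : G} (g : y ⟶ z) (a : A) (b : α.dom g) :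
    single hα ⟨y, z, g⟩ b * baseAddHom hα a =
      single hα ⟨y, z, g⟩ ⟨b * hα.act g a, hα.mul_mem_right _ _ b.2⟩ := by
  let _ := Fintype.ofFinite G
  rw [baseAddHom_apply, Finset.mul_sum, Finset.sum_eq_single y]
  · rw [single_mul_single]
    refine single_eq hα (by rw [Category.id_comp]) ?_
    change (b : A) * hα.act g (a * hα.one (𝟙 y)) = b * hα.act g a
    rw [map_mul, hα.act_one, Category.id_comp, hα.one_mul_one, (hα.mem_iff g _).1 (hα.act_mem _ _)]
  · intro b _ hb
    exact single_mul_single_of_ne hα hb _ _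
  · simp

/-- The embedding `a ↦ ∑ a 1_y δ_y` of `A` into `A ⋆_α G`. -/
noncomputable def base : A →+* SkewRing α hα :=
  { baseAddHom hα with
    map_one' := by
      let _ := Fintype.ofFinite G
      change baseAddHom hα 1 = 1
      rw [baseAddHom_apply]
      change _ = ∑ y : G, single hα ⟨y, y, 𝟙 y⟩ ⟨hα.one (𝟙 y), hα.one_mem _⟩
      refine Finset.sum_congr rfl fun y _ => ?_
      exact single_eq hα rfl (one_mul _)
    map_mul' := fun a b => by
      let _ := Fintype.ofFinite G
      change baseAddHom hα (a * b) = baseAddHom hα a * baseAddHom hα b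
      rw [baseAddHom_apply hα b, Finset.mul_sum, baseAddHom_apply]
      refine Finset.sum_congr rfl fun y _ => ?_
      rw [baseAddHom_mul_single]
      exact single_eq hα rfl (mul_assoc _ _ _) }

theorem base_mul_single {y z : G} (g : y ⟶ z) (a : A) (b : α.dom g) :
    base hα a * single hα ⟨y, z, g⟩ b = single hα ⟨y, z, g⟩ ⟨a * b, hα.mul_mem_left _ _ b.2⟩ :=
  baseAddHom_mul_single hα g a b

theorem single_mul_base {y z : G} (g : y ⟶ z) (a : A) (b : α.dom g) :
    single hα ⟨y, z, g⟩ b * base hα a =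
      single hα ⟨y, z, g⟩ ⟨b * hα.act g a, hα.mul_mem_right _ _ b.2⟩ :=
  single_mul_baseAddHom hα g a b

theorem unitCoeff_base_mul (a : A) (s : SkewRing α hα) :
    unitCoeff hα (base hα a * s) = a * unitCoeff hα s := by
  induction s using induction with
  | zero => simp
  | add s t hs ht => rw [mul_add, map_add, map_add, hs, ht, mul_add]
  | single g b =>
    by_cases hg : g ∈ Set.range fun y : G => (⟨y, y, 𝟙 y⟩ : Arr G)
    · obtain ⟨y, rfl⟩ := hg
      rw [base_mul_single, unitCoeff_single_id, unitCoeff_single_id]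
    · rw [base_mul_single, unitCoeff_single_of_notMem hα hg, unitCoeff_single_of_notMem hα hg,
        mul_zero]

theorem unitCoeff_mul_base (a : A) (s : SkewRing α hα) :
    unitCoeff hα (s * base hα a) = unitCoeff hα s * a := by
  induction s using induction with
  | zero => simp
  | add s t hs ht => rw [add_mul, map_add, map_add, hs, ht, add_mul]
  | single g b =>
    by_cases hg : g ∈ Set.range fun y : G => (⟨y, y, 𝟙 y⟩ : Arr G)
    · obtain ⟨y, rfl⟩ := hg
      rw [single_mul_base, unitCoeff_single_id, unitCoeff_single_id]
      change (b : A) * hα.act (𝟙 y) a = b * a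
      rw [hα.act_id, ← hα.one_comm, ← mul_assoc, (hα.mem_iff _ _).1 b.2]
    · rw [single_mul_base, unitCoeff_single_of_notMem hα hg, unitCoeff_single_of_notMem hα hg,
        zero_mul]

/-- This is where `A = ⨁ A_y` enters: `∑ 1_y = 1`, so no part of `a` is lost in the skew ring. -/
theorem unitCoeff_base (hsum : α.IsDirectSumOfObjects) (a : A) :
    unitCoeff hα (base hα a) = a := by
  let _ := Fintype.ofFinite G
  have h1 : unitCoeff hα 1 = 1 := by
    rw [← hsum.sum_one hα]
    change unitCoeff hα (∑ y : G, single hα ⟨y, y, 𝟙 y⟩ ⟨hα.one (𝟙 y), hα.one_mem _⟩) = _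
    rw [map_sum]
    exact Finset.sum_congr rfl fun y _ => unitCoeff_single_id hα y _
  rw [← mul_one (base hα a), unitCoeff_base_mul, h1, mul_one]

theorem isArtinianRing_coeff (hsum : α.IsDirectSumOfObjects)
    [IsArtinianRing (SkewRing α hα)] : IsArtinianRing A :=
  IsArtinianRing.of_retraction (base hα) id (unitCoeff hα)
    (fun s a => unitCoeff_mul_base hα a s) (unitCoeff_base hα hsum)
    fun r => ⟨r, 1, 1, one_mul _, (one_mul _).symm⟩

theorem isArtinianRing_op_coeff (hsum : α.IsDirectSumOfObjects)
    [IsArtinianRing (SkewRing α hα)ᵐᵒᵖ] : IsArtinianRing Aᵐᵒᵖ :=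
  IsArtinianRing.of_retraction (RingHom.op (base hα)) id (AddMonoidHom.mulOp (unitCoeff hα))
    (fun s a => MulOpposite.unop_injective (unitCoeff_base_mul hα a.unop s.unop))
    (fun a => MulOpposite.unop_injective (unitCoeff_base hα hsum a.unop))
    fun r => ⟨r, 1, 1, one_mul _, (one_mul _).symm⟩

/-- The elements `1_g δ_g` with `A_g ≠ 0`. -/
def oneSingles : Set (SkewRing α hα) :=
  (fun g : Arr G => single hα g ⟨hα.one g.2.2, hα.one_mem _⟩) '' {g | α.dom g.2.2 ≠ ⊥}

theorem isArtinianRing_of_finite (hfin : {g : Arr G | α.dom g.2.2 ≠ ⊥}.Finite)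
    [IsArtinianRing A] : IsArtinianRing (SkewRing α hα) := by
  refine IsArtinianRing.of_closure_eq_top (base hα) (W := oneSingles hα) (hfin.image _) ?_
  refine (AddSubgroup.eq_top_iff' _).2 fun s => ?_
  induction s using induction with
  | zero => exact zero_mem _
  | add s t hs ht => exact add_mem hs ht
  | single g a =>
    by_cases hg : α.dom g.2.2 = ⊥
    · rw [single_eq_zero hα hg]
      exact zero_mem _
    · refine AddSubgroup.subset_closure ⟨a, _, ⟨g, hg, rfl⟩, ?_⟩
      obtain ⟨y, z, g⟩ := g
      dsimp only
      rw [base_mul_single]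
      exact single_eq hα rfl ((hα.mem_iff _ _).1 a.2).symm

theorem isArtinianRing_op_of_finite (hfin : {g : Arr G | α.dom g.2.2 ≠ ⊥}.Finite)
    [IsArtinianRing Aᵐᵒᵖ] : IsArtinianRing (SkewRing α hα)ᵐᵒᵖ := by
  refine IsArtinianRing.of_closure_eq_top (RingHom.op (base hα))
    (W := MulOpposite.op '' oneSingles hα) ((hfin.image _).image _) ?_
  refine (AddSubgroup.eq_top_iff' _).2 fun s => ?_
  induction s using MulOpposite.rec' with | _ s
  induction s using induction with
  | zero => exact zero_mem _
  | add s t hs ht => exact add_mem hs ht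
  | single g a =>
    by_cases hg : α.dom g.2.2 = ⊥
    · rw [single_eq_zero hα hg]
      exact zero_mem _
    -- To put the coefficient on the right, write `a = α_g(b)`; then `a δ_g = (1_g δ_g) b`.
    · obtain ⟨b, -, hb⟩ := hα.exists_act_eq g.2.2 a.2
      refine AddSubgroup.subset_closure ⟨MulOpposite.op b, _, ⟨_, ⟨g, hg, rfl⟩, rfl⟩, ?_⟩
      obtain ⟨y, z, g⟩ := g
      refine MulOpposite.unop_injective ?_
      change _ = single hα ⟨y, z, g⟩ ⟨hα.one g, _⟩ * base hα b
      rw [single_mul_base]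
      refine single_eq hα rfl ?_
      change (a : A) = hα.one g * hα.act g b
      rw [hb, hα.one_comm]
      exact ((hα.mem_iff _ _).1 a.2).symm

end Base

/-! ### Retractions onto the group ring of a stabilizer -/

section Stabilizer

variable [Finite G] {x : G} {f : A} {hf : f ∈ α.dom (𝟙 x)}

/-- `a δ_l ↦ φ(a f) l` is compatible with right multiplication by `f δ_k`, because `a α_l(f) f = a
f` for `l` in the stabilizer. Outside `K` both sides vanish, `K` being a subgroup. -/
theorem finite_stabilizer (hff : IsCentralIdempotent f) (hf0 : f ≠ 0)
    [IsArtinianRing (SkewRing α hα)] : Finite (stabilizer hα f hf) := by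
  obtain ⟨F, _, hF, φ, hφ⟩ := exists_addMonoidHom_field_of_idempotent hf0 hff.1
  set K := stabilizer hα f hf with hK
  let E : SkewRing α hα →+ MonoidAlgebra F K :=
    sumAlong hα (fun k : K => (⟨x, x, (k : End x)⟩ : Arr G)) fun k =>
      (MonoidAlgebra.singleAddHom k).comp (φ.comp (AddMonoidHom.mulRight f))
  have hE : ∀ (k : K) (a : α.dom (k : End x)), E (single hα ⟨x, x, (k : End x)⟩ a) =
      MonoidAlgebra.single k (φ (a * f)) := fun k a =>
    sumAlong_single hα (arr_injective x K) k a
  have : IsArtinianRing (MonoidAlgebra F K) := by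
    refine MonoidAlgebra.isArtinianRing_of_retraction hF
      (fun k => single hα ⟨x, x, (k : End x)⟩ ⟨f, mem_dom_of_mem_stabilizer hα k.2⟩) E ?_ ?_
    · intro s k
      induction s using induction with
      | zero => simp
      | add s t hs ht => rw [add_mul, map_add, map_add, hs, ht, add_mul]
      | single g a =>
        obtain ⟨y, z, g⟩ := g
        by_cases hy : x = y
        · subst hy
          rw [single_mul_single]
          by_cases hg : (⟨x, z, g⟩ : Arr G) ∈ Set.range
            fun k : K => (⟨x, x, (k : End x)⟩ : Arr G)
          · obtain ⟨l, hl⟩ := hg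
            simp only [Sigma.mk.injEq, heq_eq_eq, true_and] at hl
            obtain ⟨rfl, hl⟩ := hl
            obtain rfl := eq_of_heq hl
            rw [hE, MonoidAlgebra.single_mul_single, mul_one]
            refine (hE (l * k) _).trans ?_
            congr 2
            change (a : A) * hα.act (l : End x) f * f = a * f
            rw [l.2.2, mul_assoc, hff.1]
          · rw [show E (single hα ⟨x, z, g⟩ a) = 0 from sumAlong_single_of_notMem hα hg a, zero_mul]
            refine sumAlong_single_of_notMem hα ?_ _
            rintro ⟨l, hl⟩
            simp only [Sigma.mk.injEq, heq_eq_eq, true_and] at hl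
            obtain ⟨rfl, hl⟩ := hl
            refine hg ⟨l * k⁻¹, ?_⟩
            have h1 : (l : End x) = (show End x from g) * (k : End x) := eq_of_heq hl
            have h2 : ((l * k⁻¹ : K) : End x) = g := by
              rw [Subgroup.coe_mul, Subgroup.coe_inv, h1, mul_inv_cancel_right]
            dsimp only
            rw [h2]
        · rw [single_mul_single_of_ne hα hy, map_zero]
          rw [show E (single hα ⟨y, z, g⟩ a) = 0 from sumAlong_single_of_notMem hα ?_ a, zero_mul]
          rintro ⟨l, hl⟩
          exact hy (congrArg Sigma.fst hl)
    · intro k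
      rw [hE, hff.1, hφ]
  exact MonoidAlgebra.finite_of_isArtinianRing hF

/-- The opposite ring is handled by inverting group elements and moving coefficients to the right:
`a δ_k` is sent to `φ(α_{k⁻¹}(a) f) k⁻¹`. -/
theorem finite_stabilizer_of_op (hff : IsCentralIdempotent f) (hf0 : f ≠ 0)
    [IsArtinianRing (SkewRing α hα)ᵐᵒᵖ] : Finite (stabilizer hα f hf) := by
  obtain ⟨F, _, hF, φ, hφ⟩ := exists_addMonoidHom_field_of_idempotent hf0 hff.1
  set K := stabilizer hα f hf with hK
  let E : SkewRing α hα →+ MonoidAlgebra F K :=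
    sumAlong hα (fun k : K => (⟨x, x, (k : End x)⟩ : Arr G)) fun k =>
      (MonoidAlgebra.singleAddHom k⁻¹).comp (φ.comp ((AddMonoidHom.mulRight f).comp
        (hα.act ((k⁻¹ : K) : End x) : A →ₙ+* A).toAddMonoidHom))
  have hE : ∀ (k : K) (a : α.dom (k : End x)), E (single hα ⟨x, x, (k : End x)⟩ a) =
      MonoidAlgebra.single k⁻¹ (φ (hα.act ((k⁻¹ : K) : End x) a * f)) := fun k a =>
    sumAlong_single hα (arr_injective x K) k a
  -- Left multiplication by `f δ_{k⁻¹}` does not change the transported coefficient once it is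
  -- multiplied by `f`, since `f` is fixed by `K` and lies below the relevant `1_{lk}`.
  have hcomm : ∀ (l k : K) (a : A), hα.act ((l * k : K) : End x)
      (f * hα.act ((k⁻¹ : K) : End x) a) * f = hα.act (l : End x) a * f := by
    intro l k a
    have h1 := hα.act_act ((k⁻¹ : K) : End x) ((l * k : K) : End x) a
    have h2 : (((k⁻¹ : K) : End x) : x ⟶ x) ≫ ((l * k : K) : End x) = (l : End x) := by
      change ((l * k : K) : End x) * ((k⁻¹ : K) : End x) = l
      rw [← Subgroup.coe_mul, mul_inv_cancel_right]
    have h3 : f * hα.one ((l * k : K) : End x) = f :=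
      (hα.mem_iff _ _).1 (mem_dom_of_mem_stabilizer hα (l * k).2)
    rw [h2] at h1
    rw [map_mul, (l * k).2.2, h1, hff.2, mul_assoc, hff.1, mul_assoc, hα.one_comm, h3]
  have : IsArtinianRing (MonoidAlgebra F K) := by
    refine MonoidAlgebra.isArtinianRing_of_retraction hF
      (fun k => MulOpposite.op (single hα ⟨x, x, ((k⁻¹ : K) : End x)⟩
        ⟨f, mem_dom_of_mem_stabilizer hα (k⁻¹).2⟩))
      (E.comp MulOpposite.opAddEquiv.symm.toAddMonoidHom) ?_ ?_
    · intro s k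
      induction s using MulOpposite.rec' with | _ s
      change E (single hα ⟨x, x, ((k⁻¹ : K) : End x)⟩ _ * s) = E s * _
      induction s using induction with
      | zero => simp
      | add s t hs ht => rw [mul_add, map_add, map_add, hs, ht, add_mul]
      | single g a =>
        obtain ⟨y, z, g⟩ := g
        by_cases hz : z = x
        · subst hz
          rw [single_mul_single]
          by_cases hg : (⟨y, z, g⟩ : Arr G) ∈ Set.range
            fun k : K => (⟨z, z, (k : End z)⟩ : Arr G)
          · obtain ⟨l, hl⟩ := hg
            simp only [Sigma.mk.injEq] at hl
            obtain ⟨rfl, hl⟩ := hl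
            simp only [heq_eq_eq, Sigma.mk.injEq, true_and] at hl
            obtain rfl := hl
            rw [hE, MonoidAlgebra.single_mul_single, mul_one]
            refine (hE (k⁻¹ * l) _).trans ?_
            have h1 : (k⁻¹ * l)⁻¹ = l⁻¹ * k := by rw [mul_inv_rev, inv_inv]
            rw [h1]
            congr 2
            exact hcomm _ _ _
          · rw [show E (single hα ⟨y, z, g⟩ a) = 0 from sumAlong_single_of_notMem hα hg a, zero_mul]
            refine sumAlong_single_of_notMem hα ?_ _
            rintro ⟨l, hl⟩
            simp only [Sigma.mk.injEq] at hl
            obtain ⟨rfl, hl⟩ := hl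
            simp only [heq_eq_eq, Sigma.mk.injEq, true_and] at hl
            refine hg ⟨k * l, ?_⟩
            have h1 : (l : End z) = ((k⁻¹ : K) : End z) * (show End z from g) := hl
            have h2 : ((k * l : K) : End z) = g := by
              rw [Subgroup.coe_mul, h1, Subgroup.coe_inv, mul_inv_cancel_left]
            dsimp only
            rw [h2]
        · rw [single_mul_single_of_ne hα hz, map_zero]
          rw [show E (single hα ⟨y, z, g⟩ a) = 0 from sumAlong_single_of_notMem hα ?_ a, zero_mul]
          rintro ⟨l, hl⟩
          exact hz (congrArg (fun g => g.2.1) hl).symm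
    · intro k
      refine (hE k⁻¹ _).trans ?_
      change MonoidAlgebra.single k⁻¹⁻¹ (φ (hα.act ((k⁻¹⁻¹ : K) : End x) f * f)) = _
      rw [inv_inv, k.2.2, hff.1, hφ]
  exact MonoidAlgebra.finite_of_isArtinianRing hF

end Stabilizer

end SkewRing

/-! ### From the isotropy group to all arrows -/

/-- `α_τ` is injective on all of `A_z` and maps `1_g` to `1_τ 1_{τg}`, which is therefore nonzero.
-/
theorem dom_comp_ne_bot_left (hα : α.IsUnital) {y z w : G} {g : y ⟶ z} (τ : z ⟶ w)
    (hτ : α.dom (Groupoid.inv τ) = α.dom (𝟙 z)) (hg : α.dom g ≠ ⊥) : α.dom (g ≫ τ) ≠ ⊥ := by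
  rw [dom_ne_bot_iff hα] at hg ⊢
  intro h0
  have h1 := hα.act_one g τ
  rw [h0, mul_zero] at h1
  have h2 := hα.act_act_inv (Groupoid.inv τ) (b := hα.one g)
    (hτ ▸ α.dom_le g (hα.one_mem g))
  rw [show Groupoid.inv (Groupoid.inv τ) = τ by simp, h1, map_zero] at h2
  exact hg h2.symm

/-- As `1_σ` is the identity of `A_y`, it acts as one on `A_{g⁻¹}`, so `α_g(1_σ) = 1_g`; the same
formula then reads `1_g = 1_g 1_{gσ}`. -/
theorem dom_comp_ne_bot_right (hα : α.IsUnital) {w y z : G} {g : y ⟶ z} (σ : w ⟶ y)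
    (hσ : α.dom σ = α.dom (𝟙 y)) (hg : α.dom g ≠ ⊥) : α.dom (σ ≫ g) ≠ ⊥ := by
  rw [dom_ne_bot_iff hα] at hg ⊢
  intro h0
  have h1 := hα.act_one σ g
  rw [h0, mul_zero, ← hα.act_mul_one, hα.one_comm, (hα.mem_iff _ _).1
    (hσ ▸ α.dom_le _ (hα.one_mem (Groupoid.inv g))), hα.act_one, Groupoid.inv_comp,
    (hα.mem_iff _ _).1 (α.dom_le g (hα.one_mem g))] at h1
  exact hg h1

theorem IsGroupType.finite_arr [Finite G] (hgt : α.IsGroupType) (hα : α.IsUnital) {x : G}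
    (hfin : {h : x ⟶ x | α.dom h ≠ ⊥}.Finite) : {g : Arr G | α.dom g.2.2 ≠ ⊥}.Finite := by
  obtain ⟨x₀, τ, -, hτ⟩ := hgt
  -- The loop runs `x → x₀ → y → z → x₀ → x`. With its endpoints recorded, `g` is recovered by
  -- cancellation, and each factor `τ` or `τ⁻¹` has full domain and full range.
  let Φ : Arr G → G × G × (x ⟶ x) := fun g =>
    (g.1, g.2.1, (Groupoid.inv (τ x) ≫ τ g.1 ≫ g.2.2) ≫ Groupoid.inv (τ g.2.1) ≫ τ x)
  have hΦ : Function.Injective Φ := by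
    rintro ⟨y, z, g⟩ ⟨y', z', g'⟩ h
    simp only [Φ, Prod.mk.injEq] at h
    obtain ⟨rfl, rfl, h⟩ := h
    obtain rfl : g = g' := by
      rw [cancel_mono, cancel_epi, cancel_epi] at h
      exact h
    rfl
  refine ((Set.finite_univ.prod (Set.finite_univ.prod hfin)).preimage hΦ.injOn).subset ?_
  rintro ⟨y, z, g⟩ hg
  refine ⟨trivial, trivial, ?_⟩
  change α.dom ((Groupoid.inv (τ x) ≫ τ y ≫ g) ≫ Groupoid.inv (τ z) ≫ τ x) ≠ ⊥
  rw [← Category.assoc]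
  refine dom_comp_ne_bot_left hα _ (hτ x).1 (dom_comp_ne_bot_left hα _ ?_
    (dom_comp_ne_bot_right hα _ (hτ x).1 (dom_comp_ne_bot_right hα _ (hτ y).2 hg)))
  rw [show Groupoid.inv (Groupoid.inv (τ z)) = τ z by simp]
  exact (hτ z).2

end GroupoidPartialAction

/-! ### The theorem -/

theorem mainTheorem6 {G : Type u} [Groupoid.{v} G] [Finite G]
    (hconn : ∀ y z : G, Nonempty (y ⟶ z))
    {A : Type w} [Ring A] (α : GroupoidPartialAction G A) (hα : α.IsUnital)
    (hgt : α.IsGroupType) (hsum : α.IsDirectSumOfObjects) (x : G) :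
    (IsArtinianRing (GroupoidPartialAction.SkewRing α hα) ↔
      IsArtinianRing A ∧ {h : x ⟶ x | α.dom h ≠ ⊥}.Finite) ∧
    (IsArtinianRing (GroupoidPartialAction.SkewRing α hα)ᵐᵒᵖ ↔
      IsArtinianRing Aᵐᵒᵖ ∧ {h : x ⟶ x | α.dom h ≠ ⊥}.Finite) := by
  refine ⟨⟨fun h => ?_, fun ⟨h, hfin⟩ => ?_⟩, ⟨fun h => ?_, fun ⟨h, hfin⟩ => ?_⟩⟩
  · have hA := GroupoidPartialAction.SkewRing.isArtinianRing_coeff hα hsum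
    refine ⟨hA, ?_⟩
    by_contra hinf
    obtain ⟨f, hf, hff, hf0, hK⟩ := GroupoidPartialAction.exists_infinite_stabilizer hα
      IsCentralIdempotent.isArtinianRing_minimal hinf
    exact not_finite_iff_infinite.2 hK
      (GroupoidPartialAction.SkewRing.finite_stabilizer hα hff hf0)
  · exact GroupoidPartialAction.SkewRing.isArtinianRing_of_finite hα (hgt.finite_arr hα hfin)
  · have hA := GroupoidPartialAction.SkewRing.isArtinianRing_op_coeff hα hsum
    refine ⟨hA, ?_⟩
    by_contra hinf
    obtain ⟨f, hf, hff, hf0, hK⟩ := GroupoidPartialAction.exists_infinite_stabilizer hα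
      IsCentralIdempotent.isArtinianRing_op_minimal hinf
    exact not_finite_iff_infinite.2 hK
      (GroupoidPartialAction.SkewRing.finite_stabilizer_of_op hα hff hf0)
  · exact GroupoidPartialAction.SkewRing.isArtinianRing_op_of_finite hα (hgt.finite_arr hα hfin)
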